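/- Let $f:(0,\infty)^2\to\mathbb R$ be a symmetric function of class $C^2$, i.e. $f(y_1,y_2)=f(y_2,y_1)$, such that $\frac{\partial f}{\partial y_1}\frac{\partial f}{\partial y_2}>0$ on $(0,\infty)^2$. Let $M_1,M_2\subset\mathbb R^3$ be two closed strictly convex surfaces of class $C^3$; that is, each $M_l$ is a regular $C^3$ surface which is the boundary of a compact convex set with nonempty interior, and all its principal curvatures (with the sign for which the unit sphere has principal curvatures $1$) are positive. Let $\kappa_1\ge\kappa_2$ denote the principal curvatures and let $\nu_{M_l}:M_l\to\mathbb S^2$ be the Gauss map (outer unit normal) of $M_l$, which is a bijection. If $$f\big(\kappa_1(\nu_{M_1}^{-1}(x)),\kappa_2(\nu_{M_1}^{-1}(x))\big)=f\big(\kappa_1(\nu_{M_2}^{-1}(x)),\kappa_2(\nu_{M_2}^{-1}(x))\big)\qquad\text{for all }x\in\mathbb S^2,$$ then $M_1$ and $M_2$ agree up to a translation: there is $a\in\mathbb R^3$ with $M_2=M_1+a$. -/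

import Mathlib

open Set Topology

/-- Euclidean three-space. -/
abbrev Space3 : Type := EuclideanSpace ℝ (Fin 3)

/-- `M` is an (embedded, boundaryless) regular surface of class `C^k`: near each of its points it
is the zero set of a `C^k` function whose differential does not vanish. -/
def IsRegularSurface (k : WithTop ℕ∞) (M : Set Space3) : Prop :=
  ∀ p ∈ M, ∃ (U : Set Space3) (g : Space3 → ℝ), IsOpen U ∧ p ∈ U ∧ ContDiffOn ℝ k g U ∧
    (∀ x ∈ U, fderiv ℝ g x ≠ 0) ∧ M ∩ U = {x ∈ U | g x = 0}

/-- `M` is a closed convex surface: the boundary of a compact convex set with interior points. -/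
def IsClosedConvexSurface (M : Set Space3) : Prop :=
  ∃ K : Set Space3, IsCompact K ∧ Convex ℝ K ∧ (interior K).Nonempty ∧ M = frontier K

/-- `n` is an outer unit normal of the convex surface `M` at `p`: it is a unit vector orthogonal
to the tangent space of `M` at `p`, and `M` lies in the half-space `⟪y - p, n⟫ ≤ 0`.
(For a regular surface, `tangentConeAt ℝ M p` is the tangent plane, the set of velocities at `p`
of the curves on `M` through `p`.) -/
def IsOuterUnitNormal (M : Set Space3) (p n : Space3) : Prop :=
  ‖n‖ = 1 ∧ (∀ v ∈ tangentConeAt ℝ M p, inner ℝ v n = 0) ∧ ∀ y ∈ M, inner ℝ (y - p) n ≤ 0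

open Classical in
/-- The Gauss map `ν_M` of a convex surface: the outer unit normal at each point of `M`
(it exists and is unique for a closed convex surface of class `C^1`; the value is `0` where no
outer unit normal exists). -/
noncomputable def gaussMap (M : Set Space3) (p : Space3) : Space3 :=
  if h : ∃ n, IsOuterUnitNormal M p n then h.choose else 0

/-- The inverse `ν_M⁻¹` of the Gauss map `ν_M : M → 𝕊²`. -/
noncomputable def inverseGaussMap (M : Set Space3) : Space3 → Space3 :=
  Function.invFunOn (gaussMap M) M

/-- The set of principal curvatures of `M` at `p`: the eigenvalues of the shape operator, i.e. of
the differential `dν_p : T_pM → T_pM` of the Gauss map along `M`. With the outer normal,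
the unit sphere has principal curvatures `1`. -/
def principalCurvatures (M : Set Space3) (p : Space3) : Set ℝ :=
  {κ | ∃ v ∈ tangentConeAt ℝ M p, v ≠ 0 ∧ fderivWithin ℝ (gaussMap M) M p v = κ • v}

/-- The larger principal curvature `κ₁`. -/
noncomputable def kappa1 (M : Set Space3) (p : Space3) : ℝ := sSup (principalCurvatures M p)

/-- The smaller principal curvature `κ₂`; it equals `κ₁` at an umbilic point. -/
noncomputable def kappa2 (M : Set Space3) (p : Space3) : ℝ := sInf (principalCurvatures M p)

/-- A closed strictly convex surface of class `C^k` (for `k ≥ 2`): a closed convex surface which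
is regular of class `C^k` and whose principal curvatures are all positive. -/
structure IsClosedStrictlyConvexSurface (k : WithTop ℕ∞) (M : Set Space3) : Prop where
  closedConvex : IsClosedConvexSurface M
  regular : IsRegularSurface k M
  curvature_pos : ∀ p ∈ M, ∀ κ ∈ principalCurvatures M p, 0 < κ

/-!
Let `X₁`, `X₂` be the inverse Gauss maps of the two surfaces, extended to be constant along rays.
They are the gradients of the support functions, and on `x^⊥` the derivative of `Xₗ` at a unit
vector `x` has the eigenvalues `1 / κ₁`, `1 / κ₂`. The curvature equation therefore says that `X₁`
and `X₂` solve the same elliptic equation, and `X = X₁ - X₂` solves a linearized one.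

For a unit vector `e`, the function `⟪X, e⟫` on the sphere satisfies a maximum principle away from
the poles `±e`, as a barrier depending on `⟪x, e⟫` shows; hence it is maximal at a pole. The width
difference `k(e) = ⟪X(e) - X(-e), e⟫` is continuous on the sphere. If it vanishes at some `e`, then
`⟪X, e⟫` is constant, which forces the derivative of `X` to vanish. Otherwise it has one sign, so
that `X` or `-X` has a positive semidefinite derivative, and ellipticity again forces this
derivative to vanish. So `X` is constant, and the surfaces differ by a translation.
-/

open NormedSpace (normalize)
open scoped NNReal

section Norm

variable {V : Type*} [NormedAddCommGroup V]

lemma norm_normalize_le_one [NormedSpace ℝ V] (x : V) : ‖normalize x‖ ≤ 1 := by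
  rcases eq_or_ne x 0 with rfl | hx
  · simp
  · exact (NormedSpace.norm_normalize_eq_one_iff.2 hx).le

lemma norm_mul_norm_normalize_sub_le [NormedSpace ℝ V] (x y : V) :
    ‖y‖ * ‖normalize x - normalize y‖ ≤ 2 * ‖x - y‖ := by
  have split : ‖y‖ • (normalize x - normalize y) = (‖y‖ - ‖x‖) • normalize x + (x - y) := by
    rw [smul_sub, sub_smul, NormedSpace.norm_smul_normalize, NormedSpace.norm_smul_normalize]
    abel
  calc ‖y‖ * ‖normalize x - normalize y‖ = ‖‖y‖ • (normalize x - normalize y)‖ := by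
        rw [norm_smul, norm_norm]
    _ ≤ |‖y‖ - ‖x‖| * ‖normalize x‖ + ‖x - y‖ := by
        rw [split, ← Real.norm_eq_abs, ← norm_smul]
        exact norm_add_le _ _
    _ ≤ ‖x - y‖ * 1 + ‖x - y‖ := by
        gcongr
        · exact norm_sub_rev x y ▸ abs_norm_sub_norm_le y x
        · exact norm_normalize_le_one x
    _ = 2 * ‖x - y‖ := by ring

lemma hasFDerivAt_norm [InnerProductSpace ℝ V] {x : V} (hx : x ≠ 0) :
    HasFDerivAt (‖·‖) (innerSL ℝ (normalize x)) x := by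
  have hx' : ‖x‖ ≠ 0 := norm_ne_zero_iff.2 hx
  have hsqrt := (hasStrictFDerivAt_norm_sq x).hasFDerivAt.sqrt (pow_ne_zero 2 hx')
  simp only [Real.sqrt_sq (norm_nonneg _)] at hsqrt
  refine hsqrt.congr_fderiv (ContinuousLinearMap.ext fun v => ?_)
  simp only [NormedSpace.normalize, map_smul, smul_apply, innerSL_apply_apply, smul_eq_mul,
    nsmul_eq_mul]
  field_simp
  norm_num

end Norm

section PositiveCone

variable {V : Type*} [NormedAddCommGroup V]

variable (V) in
/-- The open cone of the pairs `(m, v)` with `‖v‖ < m`. For `V = ℂ` it consists of the positive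
definite planar quadratic forms (see `evalForm`), for `V = ℝ` of the half sums `m` and half
differences `v` of two positive numbers. -/
def positiveCone : Set (ℝ × V) := {w | ‖w.2‖ < w.1}

variable (V) in
/-- The part of the positive cone where the eigenvalues `m ± ‖v‖` lie in `[r, R]`. -/
def eigenBox (r R : ℝ) : Set (ℝ × V) := {w | r ≤ w.1 - ‖w.2‖ ∧ w.1 + ‖w.2‖ ≤ R}

/-- The projection of `ℝ × V` onto its radial part. -/
def radialPart (w : ℝ × V) : ℝ × ℝ := (w.1, ‖w.2‖)

@[simp]
lemma radialPart_mem_positiveCone {w : ℝ × V} :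
    radialPart w ∈ positiveCone ℝ ↔ w ∈ positiveCone V := by
  simp [radialPart, positiveCone]

@[simp]
lemma radialPart_mem_eigenBox {r R : ℝ} {w : ℝ × V} :
    radialPart w ∈ eigenBox ℝ r R ↔ w ∈ eigenBox V r R := by
  simp [radialPart, eigenBox]

lemma norm_radialPart_sub_le (w w' : ℝ × V) :
    ‖radialPart w - radialPart w'‖ ≤ ‖w - w'‖ :=
  max_le_max le_rfl (abs_norm_sub_norm_le _ _)

lemma isOpen_positiveCone : IsOpen (positiveCone V) :=
  isOpen_lt (by fun_prop) (by fun_prop)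

lemma eigenBox_subset_positiveCone {r R : ℝ} (hr : 0 < r) :
    eigenBox V r R ⊆ positiveCone V :=
  fun _ hw => sub_pos.1 (hr.trans_le hw.1)

lemma axis_mem_eigenBox {r R : ℝ} {w : ℝ × V} (hw : w ∈ eigenBox V r R) :
    (w.1, (0 : V)) ∈ eigenBox V r R := by
  have := norm_nonneg w.2
  obtain ⟨hr, hR⟩ := hw
  constructor <;> simp only [norm_zero] <;> linarith

lemma isCompact_eigenBox [ProperSpace V] (r R : ℝ) : IsCompact (eigenBox V r R) := by
  have closed : IsClosed (eigenBox V r R) :=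
    (isClosed_le (f := fun _ => r) (g := fun w : ℝ × V => w.1 - ‖w.2‖) (by fun_prop)
      (by fun_prop)).inter
    (isClosed_le (f := fun w : ℝ × V => w.1 + ‖w.2‖) (g := fun _ => R) (by fun_prop)
      (by fun_prop))
  refine (isCompact_Icc.prod (isCompact_closedBall (0 : V) (R - r))).of_isClosed_subset
    (s := Icc r R ×ˢ _) closed ?_
  rintro ⟨m, v⟩ ⟨hr, hR⟩
  simp only at hr hR
  have := norm_nonneg v
  simp only [mem_prod, mem_Icc, mem_closedBall_zero_iff]
  refine ⟨⟨?_, ?_⟩, ?_⟩ <;> linarith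

lemma convex_eigenBox [NormedSpace ℝ V] (r R : ℝ) : Convex ℝ (eigenBox V r R) := by
  have norm_snd : ConvexOn ℝ univ fun w : ℝ × V => ‖w.2‖ :=
    convexOn_univ_norm.comp_linearMap (LinearMap.snd ℝ ℝ V)
  have lower := ((LinearMap.fst ℝ ℝ V).concaveOn convex_univ).sub norm_snd
  have upper := ((LinearMap.fst ℝ ℝ V).convexOn convex_univ).add norm_snd
  simpa [eigenBox, ofPred_and] using (lower.convex_ge r).inter (upper.convex_le R)

lemma exists_subset_eigenBox {S : Set (ℝ × V)} (hS : IsCompact S) (hpos : S ⊆ positiveCone V) :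
    ∃ r > 0, ∃ R, S ⊆ eigenBox V r R := by
  have lower : Continuous fun w : ℝ × V => w.1 - ‖w.2‖ := by fun_prop
  have upper : Continuous fun w : ℝ × V => w.1 + ‖w.2‖ := by fun_prop
  obtain ⟨R, hR⟩ := (hS.image upper).bddAbove
  rcases S.eq_empty_or_nonempty with rfl | hne
  · exact ⟨1, one_pos, 0, empty_subset _⟩
  obtain ⟨w₀, hw₀, hmin⟩ := hS.exists_isMinOn hne lower.continuousOn
  exact ⟨w₀.1 - ‖w₀.2‖, sub_pos.2 (hpos hw₀), R,
    fun w hw => ⟨hmin hw, hR (mem_image_of_mem _ hw)⟩⟩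

end PositiveCone

/-- A function `G (m, q)` of the half sum `m` and the half difference `q` of two positive numbers
that is symmetric in these numbers and strictly increasing in each of them: `elliptic` says that
`∂₁G ± ∂₂G > 0`. -/
structure IsEllipticRadial (G : ℝ × ℝ → ℝ) : Prop where
  contDiffOn : ContDiffOn ℝ 2 G (positiveCone ℝ)
  even : ∀ m q, (m, q) ∈ positiveCone ℝ → G (m, -q) = G (m, q)
  elliptic : ∀ p ∈ positiveCone ℝ, |fderiv ℝ G p (0, 1)| < fderiv ℝ G p (1, 0)

section RadialDerivative

variable {V : Type*} [NormedAddCommGroup V] [InnerProductSpace ℝ V] (G : ℝ × ℝ → ℝ)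

/-- The gradient of `G ∘ radialPart` in the direction of `V`. -/
noncomputable def axialGrad (w : ℝ × V) : V :=
  fderiv ℝ G (radialPart w) (0, 1) • normalize w.2

/-- The derivative of `G ∘ radialPart`. -/
noncomputable def radialFDeriv (w : ℝ × V) : ℝ × V →L[ℝ] ℝ :=
  fderiv ℝ G (radialPart w) (1, 0) • ContinuousLinearMap.fst ℝ ℝ V +
    innerSL ℝ (axialGrad G w) ∘L ContinuousLinearMap.snd ℝ ℝ V

lemma radialFDeriv_apply (w d : ℝ × V) :
    radialFDeriv G w d =
      fderiv ℝ G (radialPart w) (1, 0) * d.1 + inner ℝ (axialGrad G w) d.2 := by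
  simp [radialFDeriv]

lemma norm_axialGrad_le (w : ℝ × V) :
    ‖axialGrad G w‖ ≤ |fderiv ℝ G (radialPart w) (0, 1)| := by
  rw [axialGrad, norm_smul, Real.norm_eq_abs]
  exact mul_le_of_le_one_right (abs_nonneg _) (norm_normalize_le_one _)

end RadialDerivative

namespace IsEllipticRadial

variable {V : Type*} [NormedAddCommGroup V] [InnerProductSpace ℝ V]
  {G : ℝ × ℝ → ℝ} (hG : IsEllipticRadial G) {r R : ℝ}
include hG

lemma hasFDerivAt {p : ℝ × ℝ} (hp : p ∈ positiveCone ℝ) : HasFDerivAt G (fderiv ℝ G p) p :=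
  ((hG.contDiffOn.contDiffAt (isOpen_positiveCone.mem_nhds hp)).differentiableAt
    two_ne_zero).hasFDerivAt

lemma contDiffOn_fderiv : ContDiffOn ℝ 1 (fderiv ℝ G) (positiveCone ℝ) :=
  hG.contDiffOn.fderiv_of_isOpen isOpen_positiveCone (by norm_num)

lemma fderiv_axis {m : ℝ} (hm : 0 < m) : fderiv ℝ G (m, 0) (0, 1) = 0 := by
  have axis_mem : (m, (0 : ℝ)) ∈ positiveCone ℝ := by simpa [positiveCone] using hm
  let reflect : ℝ × ℝ →L[ℝ] ℝ × ℝ :=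
    (ContinuousLinearMap.fst ℝ ℝ ℝ).prod (-ContinuousLinearMap.snd ℝ ℝ ℝ)
  have reflect_axis : reflect (m, 0) = (m, 0) := by simp [reflect]
  have reflected : HasFDerivAt (G ∘ reflect) (fderiv ℝ G (m, 0) ∘L reflect) (m, 0) :=
    HasFDerivAt.comp _ (by rw [reflect_axis]; exact hG.hasFDerivAt axis_mem) reflect.hasFDerivAt
  have invariant : G ∘ reflect =ᶠ[𝓝 (m, 0)] G := by
    filter_upwards [isOpen_positiveCone.mem_nhds axis_mem] with p hp using hG.even p.1 p.2 hp
  have := DFunLike.congr_fun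
    ((reflected.congr_of_eventuallyEq invariant.symm).unique (hG.hasFDerivAt axis_mem)) (0, 1)
  have flip : reflect (0, 1) = -(0, 1) := by simp [reflect]
  rw [ContinuousLinearMap.comp_apply, flip, map_neg] at this
  linarith

lemma hasFDerivAt_radial_axis {w : ℝ × V} (hw : w ∈ positiveCone V) (h0 : w.2 = 0) :
    HasFDerivAt (G ∘ radialPart) (radialFDeriv G w) w := by
  have hm : 0 < w.1 := by simpa [positiveCone, h0] using hw
  have axis : radialPart w = (w.1, 0) := by simp [radialPart, h0]
  have expansion := hG.hasFDerivAt (radialPart_mem_positiveCone.2 hw)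
  rw [hasFDerivAt_iff_isLittleO_nhds_zero] at expansion ⊢
  have tendsto : Filter.Tendsto (radialPart (V := V)) (𝓝 0) (𝓝 0) := by
    have : Continuous (radialPart (V := V)) := by unfold radialPart; fun_prop
    simpa [radialPart, Prod.zero_eq_mk] using this.tendsto 0
  refine ((expansion.comp_tendsto tendsto).congr_left fun h => ?_).trans_isBigO
    (Asymptotics.IsBigO.of_bound 1 (Filter.Eventually.of_forall fun h => ?_))
  · have split : radialPart h = h.1 • ((1 : ℝ), (0 : ℝ)) + ‖h.2‖ • ((0 : ℝ), (1 : ℝ)) := by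
      simp [radialPart]
    have add : radialPart (w + h) = radialPart w + radialPart h := by simp [radialPart, h0]
    have no_axial : axialGrad G w = 0 := by rw [axialGrad, h0, NormedSpace.normalize_zero_eq_zero,
      smul_zero]
    simp only [Function.comp_apply, radialFDeriv_apply, add, no_axial, inner_zero_left]
    rw [split, map_add, map_smul, map_smul, axis, hG.fderiv_axis hm]
    simp [mul_comm]
  · simp [radialPart, Prod.norm_def]

lemma hasFDerivAt_radial {w : ℝ × V} (hw : w ∈ positiveCone V) :
    HasFDerivAt (G ∘ radialPart) (radialFDeriv G w) w := by
  rcases eq_or_ne w.2 0 with h0 | h0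
  · exact hG.hasFDerivAt_radial_axis hw h0
  have norm_snd := (hasFDerivAt_norm h0).comp w (hasFDerivAt_snd (𝕜 := ℝ))
  refine ((hG.hasFDerivAt (radialPart_mem_positiveCone.2 hw)).comp w
    (hasFDerivAt_fst.prodMk norm_snd)).congr_fderiv ?_
  ext d
  · simp [radialFDeriv_apply]
  · have axial : (((0 : ℝ), inner ℝ (normalize w.2) d) : ℝ × ℝ) =
        inner ℝ (normalize w.2) d • ((0 : ℝ), (1 : ℝ)) := by simp
    simp [radialFDeriv_apply, axialGrad, real_inner_smul_left, axial, -Prod.smul_mk, mul_comm]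

lemma exists_radialFDeriv_lower_bound (hr : 0 < r) :
    ∃ c > 0, ∀ w ∈ eigenBox V r R, ∀ d : ℝ × V, ‖d.2‖ ≤ d.1 → c * d.1 ≤ radialFDeriv G w d := by
  have hsub := eigenBox_subset_positiveCone (V := ℝ) (R := R) hr
  have continuousOn_apply (v : ℝ × ℝ) : ContinuousOn (fun p => fderiv ℝ G p v) (eigenBox ℝ r R) :=
    (hG.contDiffOn_fderiv.continuousOn.mono hsub).clm_apply continuousOn_const
  rcases (eigenBox ℝ r R).eq_empty_or_nonempty with hempty | hne
  · exact ⟨1, one_pos, fun w hw => by simp [← radialPart_mem_eigenBox, hempty] at hw⟩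
  obtain ⟨p, hp, hmin⟩ := (isCompact_eigenBox r R).exists_isMinOn hne
    ((continuousOn_apply (1, 0)).sub (continuousOn_apply (0, 1)).abs)
  refine ⟨_, sub_pos.2 (hG.elliptic p (hsub hp)), fun w hw d hd => ?_⟩
  calc _ ≤ (fderiv ℝ G (radialPart w) (1, 0) - |fderiv ℝ G (radialPart w) (0, 1)|) * d.1 :=
        mul_le_mul_of_nonneg_right (hmin (radialPart_mem_eigenBox.2 hw)) ((norm_nonneg _).trans hd)
    _ = fderiv ℝ G (radialPart w) (1, 0) * d.1 -
          |fderiv ℝ G (radialPart w) (0, 1)| * d.1 := sub_mul ..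
    _ ≤ fderiv ℝ G (radialPart w) (1, 0) * d.1 - ‖axialGrad G w‖ * ‖d.2‖ := by
        gcongr
        exact norm_axialGrad_le G w
    _ ≤ radialFDeriv G w d := by
        rw [radialFDeriv_apply]
        linarith [neg_le_of_abs_le (abs_real_inner_le_norm (axialGrad G w) d.2)]

lemma exists_lipschitzOnWith_fderiv (hr : 0 < r) :
    ∃ K : ℝ≥0, LipschitzOnWith K (fderiv ℝ G) (eigenBox ℝ r R) :=
  (hG.contDiffOn_fderiv.mono (eigenBox_subset_positiveCone hr)).exists_lipschitzOnWith one_ne_zero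
    (convex_eigenBox r R) (isCompact_eigenBox r R)

omit hG [InnerProductSpace ℝ V] in
lemma abs_fderiv_sub_le {K : ℝ≥0} (hK : LipschitzOnWith K (fderiv ℝ G) (eigenBox ℝ r R))
    {v : ℝ × ℝ} (hv : ‖v‖ = 1) {w w' : ℝ × V} (hw : w ∈ eigenBox V r R)
    (hw' : w' ∈ eigenBox V r R) :
    |fderiv ℝ G (radialPart w) v - fderiv ℝ G (radialPart w') v| ≤ K * ‖w - w'‖ :=
  calc _ ≤ ‖fderiv ℝ G (radialPart w) - fderiv ℝ G (radialPart w')‖ * ‖v‖ :=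
        ContinuousLinearMap.le_opNorm (fderiv ℝ G (radialPart w) - fderiv ℝ G (radialPart w')) v
    _ ≤ K * ‖radialPart w - radialPart w'‖ := by
        rw [hv, mul_one]
        exact hK.norm_sub_le (radialPart_mem_eigenBox.2 hw) (radialPart_mem_eigenBox.2 hw')
    _ ≤ K * ‖w - w'‖ := by gcongr; exact norm_radialPart_sub_le w w'

lemma norm_axialGrad_sub_le (hr : 0 < r) {K : ℝ≥0}
    (hK : LipschitzOnWith K (fderiv ℝ G) (eigenBox ℝ r R)) {w w' : ℝ × V}
    (hw : w ∈ eigenBox V r R) (hw' : w' ∈ eigenBox V r R) :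
    ‖axialGrad G w - axialGrad G w'‖ ≤ 3 * K * ‖w - w'‖ := by
  set D : ℝ × V → ℝ := fun w => fderiv ℝ G (radialPart w) (0, 1) with hD
  have unit : ‖((0 : ℝ), (1 : ℝ))‖ = 1 := by simp [Prod.norm_def]
  -- `∂₂G` vanishes on the axis, which compensates for the singularity of `normalize` there.
  have axial_small : |D w'| ≤ K * ‖w'.2‖ := by
    have hpos : 0 < w'.1 := (norm_nonneg _).trans_lt (eigenBox_subset_positiveCone hr hw')
    simpa [D, radialPart, hG.fderiv_axis hpos, Prod.norm_def] using
      abs_fderiv_sub_le hK unit hw' (axis_mem_eigenBox hw')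
  have split : axialGrad G w - axialGrad G w' =
      (D w - D w') • normalize w.2 + D w' • (normalize w.2 - normalize w'.2) := by
    simp only [axialGrad, hD]
    module
  calc ‖axialGrad G w - axialGrad G w'‖
      ≤ |D w - D w'| * ‖normalize w.2‖ + |D w'| * ‖normalize w.2 - normalize w'.2‖ := by
        rw [split, ← Real.norm_eq_abs, ← Real.norm_eq_abs, ← norm_smul, ← norm_smul]
        exact norm_add_le _ _
    _ ≤ K * ‖w - w'‖ * 1 + K * ‖w'.2‖ * ‖normalize w.2 - normalize w'.2‖ := by
        gcongr
        · exact abs_fderiv_sub_le hK unit hw hw'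
        · exact norm_normalize_le_one _
    _ = K * ‖w - w'‖ + K * (‖w'.2‖ * ‖normalize w.2 - normalize w'.2‖) := by ring
    _ ≤ K * ‖w - w'‖ + K * (2 * ‖w - w'‖) := by
        gcongr K * ‖w - w'‖ + K * ?_
        exact (norm_mul_norm_normalize_sub_le w.2 w'.2).trans
          (mul_le_mul_of_nonneg_left (norm_snd_le (w - w')) zero_le_two)
    _ = 3 * K * ‖w - w'‖ := by ring

lemma exists_lipschitzOnWith_radialFDeriv (hr : 0 < r) :
    ∃ K : ℝ≥0, LipschitzOnWith K (radialFDeriv (V := V) G) (eigenBox V r R) := by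
  obtain ⟨K, hK⟩ := hG.exists_lipschitzOnWith_fderiv (R := R) hr
  refine ⟨4 * K, LipschitzOnWith.of_dist_le_mul fun w hw w' hw' => ?_⟩
  rw [dist_eq_norm, dist_eq_norm]
  refine ContinuousLinearMap.opNorm_le_bound _ (by positivity) fun d => ?_
  have split : (radialFDeriv G w - radialFDeriv G w') d =
      (fderiv ℝ G (radialPart w) (1, 0) - fderiv ℝ G (radialPart w') (1, 0)) * d.1 +
        inner ℝ (axialGrad G w - axialGrad G w') d.2 := by
    rw [sub_apply, radialFDeriv_apply, radialFDeriv_apply, inner_sub_left]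
    ring
  calc ‖(radialFDeriv G w - radialFDeriv G w') d‖
      ≤ |fderiv ℝ G (radialPart w) (1, 0) - fderiv ℝ G (radialPart w') (1, 0)| * |d.1| +
        ‖axialGrad G w - axialGrad G w'‖ * ‖d.2‖ := by
        rw [split, ← abs_mul]
        exact (abs_add_le _ _).trans (by gcongr; exact abs_real_inner_le_norm _ _)
    _ ≤ K * ‖w - w'‖ * ‖d‖ + 3 * K * ‖w - w'‖ * ‖d‖ := by
        gcongr
        · exact abs_fderiv_sub_le hK (by simp [Prod.norm_def]) hw hw'
        · exact norm_fst_le d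
        · exact hG.norm_axialGrad_sub_le hr hK hw hw'
        · exact norm_snd_le d
    _ = ↑(4 * K) * ‖w - w'‖ * ‖d‖ := by push_cast; ring

lemma exists_norm_radialFDeriv_le [ProperSpace V] (hr : 0 < r) :
    ∃ C, ∀ w ∈ eigenBox V r R, ‖radialFDeriv G w‖ ≤ C := by
  obtain ⟨K, hK⟩ := hG.exists_lipschitzOnWith_radialFDeriv (V := V) (R := R) hr
  exact (isCompact_eigenBox r R).exists_bound_of_continuousOn (E := ℝ × V →L[ℝ] ℝ) hK.continuousOn

lemma exists_radialFDeriv_sub_eq_zero (hr : 0 < r) {w w' : ℝ × V} (hw : w ∈ eigenBox V r R)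
    (hw' : w' ∈ eigenBox V r R) (heq : G (radialPart w) = G (radialPart w')) :
    ∃ x ∈ eigenBox V r R, radialFDeriv G x (w - w') = 0 := by
  obtain ⟨x, hx, hmean⟩ := domain_mvt (f := G ∘ radialPart) (f' := radialFDeriv G)
    (fun x hx => (hG.hasFDerivAt_radial (eigenBox_subset_positiveCone hr hx)).hasFDerivWithinAt)
    (convex_eigenBox r R) hw' hw
  exact ⟨x, (convex_eigenBox r R).segment_subset hw' hw hx, hmean ▸ sub_eq_zero.2 heq⟩

lemma eq_of_norm_sub_le {w w' : ℝ × V} (hw : w ∈ positiveCone V) (hw' : w' ∈ positiveCone V)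
    (heq : G (radialPart w) = G (radialPart w')) (hle : ‖w.2 - w'.2‖ ≤ w.1 - w'.1) : w = w' := by
  obtain ⟨r, hr, R, hbox⟩ := exists_subset_eigenBox (S := {w, w'})
    (Set.toFinite _).isCompact (pair_subset hw hw')
  obtain ⟨x, hx, hzero⟩ := hG.exists_radialFDeriv_sub_eq_zero hr
    (hbox (mem_insert _ _)) (hbox (mem_insert_of_mem _ rfl)) heq
  obtain ⟨c, hc, hlower⟩ := hG.exists_radialFDeriv_lower_bound (V := V) (R := R) hr
  have fst_le : w.1 - w'.1 ≤ 0 :=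
    nonpos_of_mul_nonpos_right ((hlower x hx (w - w') hle).trans_eq hzero) hc
  have fst_eq : w.1 - w'.1 = 0 := fst_le.antisymm ((norm_nonneg _).trans hle)
  exact Prod.ext (sub_eq_zero.1 fst_eq) (sub_eq_zero.1 (norm_le_zero_iff.1 (fst_eq ▸ hle)))

end IsEllipticRadial

section PlanarForms

/-- The quadratic form on the plane encoded by a point `w` of `ℝ × ℂ`: `w.1` is its half trace and
`w.2` its trace-free part, so its eigenvalues are `w.1 ± ‖w.2‖`. -/
noncomputable def evalForm (w : ℝ × ℂ) (s t : ℝ) : ℝ :=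
  w.1 * (s ^ 2 + t ^ 2) + w.2.re * (s ^ 2 - t ^ 2) + w.2.im * (2 * s * t)

lemma exists_evalForm_eq_sub (w : ℝ × ℂ) :
    ∃ s t : ℝ, s ^ 2 + t ^ 2 = 1 ∧ evalForm w s t = w.1 - ‖w.2‖ := by
  obtain ⟨u, hu, hwu⟩ : ∃ u : ℂ, ‖u‖ = 1 ∧ w.2.re * u.re + w.2.im * u.im = -‖w.2‖ := by
    rcases eq_or_ne w.2 0 with h | h
    · exact ⟨1, by simp, by simp [h]⟩
    refine ⟨-NormedSpace.normalize w.2,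
      by rwa [norm_neg, NormedSpace.norm_normalize_eq_one_iff], ?_⟩
    have := Complex.sq_norm_sub_sq_re w.2
    have := norm_ne_zero_iff.2 h
    simp only [NormedSpace.normalize, Complex.neg_re, Complex.neg_im, Complex.smul_re,
      Complex.smul_im, smul_eq_mul]
    field_simp
    linarith
  -- The form at `s + t * I` is `w.1 * ‖ζ‖ ^ 2 + re (conj w.2 * ζ ^ 2)` with `ζ = s + t * I`.
  obtain ⟨ζ, rfl⟩ := IsAlgClosed.exists_pow_nat_eq u two_pos
  have hζ : ζ.re ^ 2 + ζ.im ^ 2 = 1 := by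
    rw [norm_pow] at hu
    rw [← hu, Complex.sq_norm, Complex.normSq_apply]
    ring
  refine ⟨ζ.re, ζ.im, hζ, ?_⟩
  simp only [pow_two ζ, Complex.mul_re, Complex.mul_im] at hwu
  rw [evalForm, hζ]
  linarith

lemma norm_snd_le_neg_fst {w : ℝ × ℂ} (h : ∀ s t, s ^ 2 + t ^ 2 = 1 → evalForm w s t ≤ 0) :
    ‖w.2‖ ≤ -w.1 := by
  obtain ⟨s, t, hst, heval⟩ := exists_evalForm_eq_sub (-w)
  have hneg : evalForm (-w) s t = -evalForm w s t := by simp [evalForm]; ring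
  have := h s t hst
  simp only [Prod.fst_neg, Prod.snd_neg, norm_neg] at heval
  linarith

end PlanarForms

section Frames

variable {E : Type*} [NormedAddCommGroup E] [InnerProductSpace ℝ E]

/-- `x, a, b` are orthonormal; `x` is thought of as a point of the unit sphere and `a, b` as a frame
of its tangent plane there. -/
structure IsFrame (x a b : E) : Prop where
  norm_x : ‖x‖ = 1
  norm_a : ‖a‖ = 1
  norm_b : ‖b‖ = 1
  inner_xa : inner ℝ x a = 0
  inner_xb : inner ℝ x b = 0
  inner_ab : inner ℝ a b = 0

/-- The quadratic form of `W` on the plane of `a` and `b`, encoded as in `evalForm`. -/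
noncomputable def planarForm (W : E →L[ℝ] E) (a b : E) : ℝ × ℂ :=
  ((inner ℝ (W a) a + inner ℝ (W b) b) / 2,
    ((inner ℝ (W a) a - inner ℝ (W b) b) / 2 : ℝ) + (inner ℝ (W a) b : ℝ) * Complex.I)

lemma planarForm_sub (W W' : E →L[ℝ] E) (a b : E) :
    planarForm (W - W') a b = planarForm W a b - planarForm W' a b := by
  refine Prod.ext ?_ (Complex.ext ?_ ?_) <;> simp [planarForm, inner_sub_left] <;> ring

lemma evalForm_planarForm {W : E →L[ℝ] E} {a b : E} (hW : inner ℝ (W b) a = inner ℝ (W a) b)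
    (s t : ℝ) : evalForm (planarForm W a b) s t = inner ℝ (W (s • a + t • b)) (s • a + t • b) := by
  simp [evalForm, planarForm, inner_add_left, inner_add_right, real_inner_smul_left,
    real_inner_smul_right, hW]
  ring

lemma norm_planarForm_le (W : E →L[ℝ] E) {a b : E} (ha : ‖a‖ = 1) (hb : ‖b‖ = 1) :
    ‖planarForm W a b‖ ≤ 2 * ‖W‖ := by
  have entry_le (u v : E) (hu : ‖u‖ = 1) (hv : ‖v‖ = 1) : |inner ℝ (W u) v| ≤ ‖W‖ :=
    calc |inner ℝ (W u) v| ≤ ‖W u‖ * ‖v‖ := abs_real_inner_le_norm _ _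
      _ ≤ ‖W‖ * ‖u‖ * ‖v‖ := by gcongr; exact W.le_opNorm u
      _ = ‖W‖ := by rw [hu, hv, mul_one, mul_one]
  have haa := abs_le.1 (entry_le a a ha ha)
  have hbb := abs_le.1 (entry_le b b hb hb)
  refine max_le (abs_le.2 ?_) ((norm_add_le _ _).trans ?_)
  · constructor <;> simp only [planarForm] <;> linarith
  · have re_le : |(inner ℝ (W a) a - inner ℝ (W b) b) / 2| ≤ ‖W‖ :=
      abs_le.2 ⟨by linarith, by linarith⟩
    rw [Complex.norm_real, norm_mul, Complex.norm_I, mul_one, Complex.norm_real]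
    exact (add_le_add re_le (entry_le a b ha hb)).trans_eq (two_mul _).symm

lemma hasDerivAt_planarForm {W : ℝ → E →L[ℝ] E} {W' : E →L[ℝ] E} {a : ℝ → E} {a' b : E} {s : ℝ}
    (hW : HasDerivAt W W' s) (ha : HasDerivAt a a' s) (map_a' : W s a' = 0)
    (inner_a' : inner ℝ (W s (a s)) a' = 0) :
    HasDerivAt (fun s => planarForm (W s) (a s) b) (planarForm W' (a s) b) s := by
  have aa := (hW.clm_apply ha).inner ℝ ha
  have ab := (hW.clm_apply ha).inner ℝ (hasDerivAt_const s b)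
  have bb := (hW.clm_apply (hasDerivAt_const s b)).inner ℝ (hasDerivAt_const s b)
  refine (((aa.add bb).div_const 2).prodMk
    (((aa.sub bb).div_const 2).ofReal_comp.add (ab.ofReal_comp.mul_const Complex.I))).congr_deriv ?_
  simp [planarForm, map_a', inner_a']

lemma IsFrame.norm_comb {x a b : E} (h : IsFrame x a b) {s t : ℝ} (hst : s ^ 2 + t ^ 2 = 1) :
    ‖s • a + t • b‖ = 1 := by
  rw [← pow_eq_one_iff_of_nonneg (norm_nonneg _) two_ne_zero, norm_add_sq_real, norm_smul,
    norm_smul, real_inner_smul_left, real_inner_smul_right, h.norm_a, h.norm_b, h.inner_ab]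
  simpa using hst

lemma IsFrame.inner_comb {x a b : E} (h : IsFrame x a b) (s t : ℝ) :
    inner ℝ x (s • a + t • b) = 0 := by
  simp [inner_add_right, real_inner_smul_right, h.inner_xa, h.inner_xb]

lemma exists_unit_mem_orthogonal {S : Submodule ℝ E} [S.HasOrthogonalProjection] (hS : S ≠ ⊤) :
    ∃ b ∈ Sᗮ, ‖b‖ = 1 := by
  obtain ⟨b, hb, hb0⟩ := Sᗮ.exists_mem_ne_zero_of_ne_bot (mt S.orthogonal_eq_bot_iff.1 hS)
  exact ⟨normalize b, Sᗮ.smul_mem _ hb, NormedSpace.norm_normalize_eq_one_iff.2 hb0⟩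

lemma span_ne_top_of_card_lt (s : Finset Space3) (hs : s.card < 3) :
    Submodule.span ℝ (s : Set Space3) ≠ ⊤ := fun h => by
  have := finrank_span_finset_le_card (R := ℝ) s
  rw [Set.finrank, h, finrank_top, finrank_euclideanSpace_fin] at this
  omega

lemma exists_unit_perp (x : Space3) : ∃ a : Space3, ‖a‖ = 1 ∧ inner ℝ x a = 0 := by
  obtain ⟨a, ha, norm_a⟩ := exists_unit_mem_orthogonal (span_ne_top_of_card_lt {x} (by simp))
  exact ⟨a, norm_a, (Submodule.mem_orthogonal _ _).1 ha x (Submodule.subset_span (by simp))⟩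

lemma exists_isFrame {x a : Space3} (hx : ‖x‖ = 1) (ha : ‖a‖ = 1) (hxa : inner ℝ x a = 0) :
    ∃ b, IsFrame x a b := by
  classical
  obtain ⟨b, hb, norm_b⟩ := exists_unit_mem_orthogonal
    (span_ne_top_of_card_lt {x, a} (Finset.card_le_two.trans_lt (by norm_num)))
  rw [Submodule.mem_orthogonal] at hb
  exact ⟨b, hx, ha, norm_b, hxa, hb x (Submodule.subset_span (by simp)),
    hb a (Submodule.subset_span (by simp))⟩

lemma IsFrame.expand {x a b : Space3} (h : IsFrame x a b) {d : Space3} (hd : inner ℝ x d = 0) :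
    d = (inner ℝ a d : ℝ) • a + (inner ℝ b d : ℝ) • b := by
  have orthonormal : Orthonormal ℝ ![x, a, b] := by
    rw [orthonormal_iff_ite]
    intro i j
    fin_cases i <;> fin_cases j <;>
      simp [h.norm_x, h.norm_a, h.norm_b, h.inner_xa, h.inner_xb, h.inner_ab,
        real_inner_comm x a, real_inner_comm x b, real_inner_comm a b]
  let B := (basisOfOrthonormalOfCardEqFinrank orthonormal (by simp)).toOrthonormalBasis
    (by simpa using orthonormal)
  simpa [B, Fin.sum_univ_three, hd] using (B.sum_repr' d).symm

lemma exists_isFrame_of_sq_inner_lt_one {p e : Space3} (hp : ‖p‖ = 1) (he : ‖e‖ = 1)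
    (h : inner ℝ p e ^ 2 < 1) :
    ∃ a b, ∃ σ > 0, IsFrame p a b ∧ σ ^ 2 = 1 - inner ℝ p e ^ 2 ∧ e = inner ℝ p e • p + σ • a := by
  set z : ℝ := inner ℝ p e
  have norm_sq : ‖e - z • p‖ ^ 2 = 1 - z ^ 2 := by
    rw [norm_sub_sq_real, norm_smul, real_inner_smul_right, real_inner_comm, hp, he,
      Real.norm_eq_abs, mul_one, sq_abs]
    ring
  have hne : e - z • p ≠ 0 := fun h0 => by
    rw [h0, norm_zero] at norm_sq
    linarith
  have hpa : inner ℝ p (normalize (e - z • p)) = 0 := by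
    simp [NormedSpace.normalize, real_inner_smul_right, inner_sub_right, hp, z]
  obtain ⟨b, hframe⟩ := exists_isFrame hp (NormedSpace.norm_normalize_eq_one_iff.2 hne) hpa
  exact ⟨_, b, _, norm_pos_iff.2 hne, hframe, norm_sq, by
    rw [NormedSpace.norm_smul_normalize, add_sub_cancel]⟩

end Frames

section GreatCircle

variable {E : Type*} [NormedAddCommGroup E] [InnerProductSpace ℝ E]

/-- The unit speed parametrization of the great circle through `p` with velocity `a` at time `0`. -/
noncomputable def greatCircle (p a : E) (s : ℝ) : E := Real.cos s • p + Real.sin s • a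

@[simp] lemma greatCircle_zero (p a : E) : greatCircle p a 0 = p := by simp [greatCircle]

lemma hasDerivAt_greatCircle (p a : E) (s : ℝ) :
    HasDerivAt (greatCircle p a) (greatCircle a (-p) s) s :=
  (((Real.hasDerivAt_cos s).smul_const p).add ((Real.hasDerivAt_sin s).smul_const a)).congr_deriv
    (by rw [greatCircle, smul_neg, neg_smul, add_comm])

lemma norm_greatCircle {p a : E} (hp : ‖p‖ = 1) (ha : ‖a‖ = 1) (hpa : inner ℝ p a = 0) (s : ℝ) :
    ‖greatCircle p a s‖ = 1 := by
  rw [← pow_eq_one_iff_of_nonneg (norm_nonneg _) two_ne_zero, greatCircle, norm_add_sq_real,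
    norm_smul, norm_smul, real_inner_smul_left, real_inner_smul_right, hp, ha, hpa]
  simp

lemma IsFrame.greatCircle {p a b : E} (h : IsFrame p a b) (s : ℝ) :
    IsFrame (greatCircle p a s) (greatCircle a (-p) s) b := by
  have hap : inner ℝ a (-p) = 0 := by rw [inner_neg_right, real_inner_comm, h.inner_xa, neg_zero]
  refine ⟨norm_greatCircle h.norm_x h.norm_a h.inner_xa s,
    norm_greatCircle h.norm_a (by rw [norm_neg, h.norm_x]) hap s, h.norm_b, ?_, ?_, ?_⟩
  · simp [_root_.greatCircle, inner_add_left, inner_add_right, real_inner_smul_left,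
      real_inner_smul_right, h.norm_x, h.norm_a, h.inner_xa, real_inner_comm p a]
    ring
  all_goals simp [_root_.greatCircle, inner_add_left, real_inner_smul_left, h.inner_xb, h.inner_ab]

end GreatCircle

lemma second_deriv_nonpos_of_isLocalMax {φ φ' : ℝ → ℝ} {φ'' t : ℝ}
    (hφ : ∀ s, HasDerivAt φ (φ' s) s) (hφ' : HasDerivAt φ' φ'' t) (hmax : IsLocalMax φ t) :
    φ'' ≤ 0 := by
  by_contra! hpos
  have deriv_eq : deriv φ = φ' := funext fun s => (hφ s).deriv
  have hmin : IsLocalMin φ t := isLocalMin_of_deriv_deriv_pos (by rwa [deriv_eq, hφ'.deriv])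
    (by rw [deriv_eq, hmax.hasDerivAt_eq_zero (hφ t)]) (hφ t).continuousAt
  have eventually_const : φ =ᶠ[𝓝 t] fun _ => φ t := by
    filter_upwards [hmax, hmin] with s hle hge using le_antisymm hle hge
  have deriv_zero : φ' =ᶠ[𝓝 t] fun _ => 0 := by
    filter_upwards [eventually_const.eventuallyEq_nhds] with s hs
    exact (hφ s).unique ((hasDerivAt_const s (φ t)).congr_of_eventuallyEq hs)
  exact hpos.ne' (hφ'.unique ((hasDerivAt_const t (0 : ℝ)).congr_of_eventuallyEq deriv_zero))

section SupportGradient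

variable {E : Type*} [NormedAddCommGroup E] [InnerProductSpace ℝ E]

/-- `X` is, away from the origin, the gradient of a positively homogeneous function of degree one
and class `C³`, such as the support function of a convex body: the inverse Gauss map of the
boundary, extended to be constant along rays. -/
structure IsSupportGradient (X : E → E) : Prop where
  contDiffOn : ContDiffOn ℝ 2 X {0}ᶜ
  map_smul : ∀ c : ℝ, 0 < c → ∀ x, X (c • x) = X x
  symm : ∀ x ≠ 0, ∀ a b, inner ℝ (fderiv ℝ X x a) b = inner ℝ a (fderiv ℝ X x b)

namespace IsSupportGradient

variable {X X₁ X₂ : E → E} {x : E}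

lemma map_normalize (h : IsSupportGradient X) (x : E) : X (normalize x) = X x := by
  rcases eq_or_ne x 0 with rfl | hx
  · rw [NormedSpace.normalize_zero_eq_zero]
  · exact h.map_smul _ (inv_pos.2 (norm_pos_iff.2 hx)) x

lemma hasFDerivAt (h : IsSupportGradient X) (hx : x ≠ 0) : HasFDerivAt X (fderiv ℝ X x) x :=
  ((h.contDiffOn.contDiffAt (isOpen_compl_singleton.mem_nhds hx)).differentiableAt
    two_ne_zero).hasFDerivAt

lemma contDiffOn_fderiv (h : IsSupportGradient X) : ContDiffOn ℝ 1 (fderiv ℝ X) {0}ᶜ :=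
  h.contDiffOn.fderiv_of_isOpen isOpen_compl_singleton one_add_one_eq_two.le

lemma hasFDerivAt_fderiv (h : IsSupportGradient X) (hx : x ≠ 0) :
    HasFDerivAt (fderiv ℝ X) (fderiv ℝ (fderiv ℝ X) x) x :=
  ((h.contDiffOn_fderiv.contDiffAt (isOpen_compl_singleton.mem_nhds hx)).differentiableAt
    one_ne_zero).hasFDerivAt

lemma fderiv_sub (h₁ : IsSupportGradient X₁) (h₂ : IsSupportGradient X₂) (hx : x ≠ 0) :
    fderiv ℝ (X₁ - X₂) x = fderiv ℝ X₁ x - fderiv ℝ X₂ x :=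
  ((h₁.hasFDerivAt hx).sub (h₂.hasFDerivAt hx)).fderiv

lemma fderiv_fderiv_sub (h₁ : IsSupportGradient X₁) (h₂ : IsSupportGradient X₂) (hx : x ≠ 0) :
    fderiv ℝ (fderiv ℝ (X₁ - X₂)) x = fderiv ℝ (fderiv ℝ X₁) x - fderiv ℝ (fderiv ℝ X₂) x := by
  have eventually_sub : fderiv ℝ (X₁ - X₂) =ᶠ[𝓝 x] fderiv ℝ X₁ - fderiv ℝ X₂ := by
    filter_upwards [isOpen_compl_singleton.mem_nhds hx] with y hy using h₁.fderiv_sub h₂ hy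
  rw [eventually_sub.fderiv_eq]
  exact ((h₁.hasFDerivAt_fderiv hx).sub (h₂.hasFDerivAt_fderiv hx)).fderiv

lemma sub (h₁ : IsSupportGradient X₁) (h₂ : IsSupportGradient X₂) :
    IsSupportGradient (X₁ - X₂) where
  contDiffOn := h₁.contDiffOn.sub h₂.contDiffOn
  map_smul c hc x := by simp [h₁.map_smul c hc x, h₂.map_smul c hc x]
  symm x hx a b := by
    simp [h₁.fderiv_sub h₂ hx, inner_sub_left, inner_sub_right, h₁.symm x hx, h₂.symm x hx]

lemma smul_fderiv_smul (h : IsSupportGradient X) {c : ℝ} (hc : 0 < c) (x : E) :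
    c • fderiv ℝ X (c • x) = fderiv ℝ X x := by
  rw [← fderiv_comp_smul, funext (h.map_smul c hc)]

-- Euler's relation for homogeneity of degree zero.
lemma fderiv_self (h : IsSupportGradient X) (hx : x ≠ 0) : fderiv ℝ X x x = 0 := by
  have along_ray : HasDerivAt (fun c : ℝ => X (c • x)) (fderiv ℝ X x x) 1 := by
    have hray : HasDerivAt (fun c : ℝ => c • x) x 1 := by
      simpa using (hasDerivAt_id (1 : ℝ)).smul_const x
    refine HasFDerivAt.comp_hasDerivAt (1 : ℝ) ?_ hray
    rw [one_smul]
    exact h.hasFDerivAt hx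
  have eventually_const : (fun c : ℝ => X (c • x)) =ᶠ[𝓝 1] fun _ => X x := by
    filter_upwards [lt_mem_nhds one_pos] with c hc using h.map_smul c hc x
  exact along_ray.unique ((hasDerivAt_const (1 : ℝ) (X x)).congr_of_eventuallyEq eventually_const)

lemma inner_fderiv_self (h : IsSupportGradient X) (hx : x ≠ 0) (v : E) :
    inner ℝ (fderiv ℝ X x v) x = 0 := by
  rw [h.symm x hx, h.fderiv_self hx, inner_zero_right]

lemma fderiv_fderiv_apply_self (h : IsSupportGradient X) (hx : x ≠ 0) (a : E) :
    fderiv ℝ (fderiv ℝ X) x a x = -fderiv ℝ X x a := by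
  have product_rule : HasFDerivAt (fun y => fderiv ℝ X y y) _ x :=
    (h.hasFDerivAt_fderiv hx).clm_apply (hasFDerivAt_id x)
  have eventually_zero : (fun y => fderiv ℝ X y y) =ᶠ[𝓝 x] fun _ => 0 := by
    filter_upwards [isOpen_compl_singleton.mem_nhds hx] with y hy using h.fderiv_self hy
  have := DFunLike.congr_fun (product_rule.unique
    ((hasFDerivAt_const (0 : E) x).congr_of_eventuallyEq eventually_zero)) a
  exact eq_neg_of_add_eq_zero_right (by simpa using this)

lemma inner_fderiv_fderiv (h : IsSupportGradient X) (hx : x ≠ 0) (a b c : E) :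
    inner ℝ (fderiv ℝ (fderiv ℝ X) x a b) c = inner ℝ b (fderiv ℝ (fderiv ℝ X) x a c) := by
  have hasFDerivAt_apply (v : E) :=
    (h.hasFDerivAt_fderiv hx).clm_apply (hasFDerivAt_const v x)
  have left := (hasFDerivAt_apply b).inner ℝ (hasFDerivAt_const c x)
  have right := (hasFDerivAt_const b x).inner ℝ (hasFDerivAt_apply c)
  have eventually_symm : (fun y => inner ℝ (fderiv ℝ X y b) c) =ᶠ[𝓝 x]
      fun y => inner ℝ b (fderiv ℝ X y c) := by
    filter_upwards [isOpen_compl_singleton.mem_nhds hx] with y hy using h.symm y hy b c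
  simpa using DFunLike.congr_fun (left.unique (right.congr_of_eventuallyEq eventually_symm)) a

lemma fderiv_fderiv_comm (h : IsSupportGradient X) (hx : x ≠ 0) (a b : E) :
    fderiv ℝ (fderiv ℝ X) x a b = fderiv ℝ (fderiv ℝ X) x b a :=
  (h.contDiffOn.contDiffAt (isOpen_compl_singleton.mem_nhds hx)).isSymmSndFDerivAt (by simp) a b

lemma exists_norm_fderiv_fderiv_le [ProperSpace E] (h : IsSupportGradient X) :
    ∃ C, ∀ x, ‖x‖ = 1 → ‖fderiv ℝ (fderiv ℝ X) x‖ ≤ C := by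
  have hcont : ContinuousOn (fderiv ℝ (fderiv ℝ X)) (Metric.sphere 0 1) :=
    (h.contDiffOn_fderiv.continuousOn_fderiv_of_isOpen isOpen_compl_singleton le_rfl).mono
      fun x hx => ne_zero_of_mem_unit_sphere ⟨x, hx⟩
  obtain ⟨C, hC⟩ := (isCompact_sphere (0 : E) 1).exists_bound_of_continuousOn
    (E := E →L[ℝ] E →L[ℝ] E) hcont
  exact ⟨C, fun x hx => hC x (mem_sphere_zero_iff_norm.2 hx)⟩

lemma hasDerivAt_comp_greatCircle (h : IsSupportGradient X) {p a : E} (hp : ‖p‖ = 1)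
    (ha : ‖a‖ = 1) (hpa : inner ℝ p a = 0) (s : ℝ) :
    HasDerivAt (fun s => X (greatCircle p a s))
      (fderiv ℝ X (greatCircle p a s) (greatCircle a (-p) s)) s :=
  (h.hasFDerivAt (norm_ne_zero_iff.1 ((norm_greatCircle hp ha hpa s).trans_ne one_ne_zero)))
    |>.comp_hasDerivAt s (hasDerivAt_greatCircle p a s)

lemma hasDerivAt_fderiv_comp_greatCircle (h : IsSupportGradient X) {p : E} (hp : p ≠ 0) (a : E) :
    HasDerivAt (fun s => fderiv ℝ X (greatCircle p a s)) (fderiv ℝ (fderiv ℝ X) p a) 0 := by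
  have hderiv := h.hasFDerivAt_fderiv ((greatCircle_zero p a).trans_ne hp)
  refine (hderiv.comp_hasDerivAt (0 : ℝ) (hasDerivAt_greatCircle p a 0)).congr_deriv ?_
  rw [greatCircle_zero, greatCircle_zero]

end IsSupportGradient

end SupportGradient

section Barrier

/-- The quadratic form `s ^ 2`, encoded as in `evalForm`. -/
noncomputable def sqForm₁ : ℝ × ℂ := (1 / 2, 1 / 2)

/-- The quadratic form `t ^ 2`, encoded as in `evalForm`. -/
noncomputable def sqForm₂ : ℝ × ℂ := (1 / 2, -1 / 2)

lemma norm_snd_sqForm₁ : ‖sqForm₁.2‖ = sqForm₁.1 := by simp [sqForm₁]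

lemma norm_snd_sqForm₂ : ‖sqForm₂.2‖ = sqForm₂.1 := by simp [sqForm₂]

variable {G : ℝ × ℝ → ℝ} {r R : ℝ}

-- Ellipticity of the linearized equation controls `t` by `s`.
lemma IsEllipticRadial.exists_norm_sub_le (hG : IsEllipticRadial G) (hr : 0 < r) :
    ∃ M, ∀ w₁ ∈ eigenBox ℂ r R, ∀ w₂ ∈ eigenBox ℂ r R, G (radialPart w₁) = G (radialPart w₂) →
      ∀ s t : ℝ, w₁ - w₂ = s • sqForm₁ + t • sqForm₂ → ‖w₁ - w₂‖ ≤ M * |s| := by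
  obtain ⟨c, hc, lower⟩ := hG.exists_radialFDeriv_lower_bound (V := ℂ) (R := R) hr
  obtain ⟨C, upper⟩ := hG.exists_norm_radialFDeriv_le (V := ℂ) (R := R) hr
  refine ⟨‖sqForm₁‖ + C * ‖sqForm₁‖ / (c * sqForm₂.1) * ‖sqForm₂‖, ?_⟩
  intro w₁ hw₁ w₂ hw₂ heq s t hst
  obtain ⟨x, hx, kernel⟩ := hG.exists_radialFDeriv_sub_eq_zero hr hw₁ hw₂ heq
  have hpos : 0 < c * sqForm₂.1 := mul_pos hc (by norm_num [sqForm₂])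
  have ht : |t| ≤ C * ‖sqForm₁‖ / (c * sqForm₂.1) * |s| := by
    have balance : t * radialFDeriv G x sqForm₂ = -(s * radialFDeriv G x sqForm₁) := by
      rw [hst] at kernel
      simp only [map_add, map_smul, smul_eq_mul] at kernel
      linarith
    rw [div_mul_eq_mul_div, le_div_iff₀ hpos]
    calc |t| * (c * sqForm₂.1) ≤ |t| * |radialFDeriv G x sqForm₂| := by
          gcongr
          exact (lower x hx _ norm_snd_sqForm₂.le).trans (le_abs_self _)
      _ = |s| * |radialFDeriv G x sqForm₁| := by rw [← abs_mul, balance, abs_neg, abs_mul]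
      _ ≤ |s| * (C * ‖sqForm₁‖) := by
          gcongr
          exact (radialFDeriv G x).le_of_opNorm_le (upper x hx) _
      _ = C * ‖sqForm₁‖ * |s| := mul_comm _ _
  calc ‖w₁ - w₂‖ ≤ |s| * ‖sqForm₁‖ + |t| * ‖sqForm₂‖ := by
        rw [hst]
        exact (norm_add_le _ _).trans_eq (by rw [norm_smul, norm_smul]; rfl)
    _ ≤ |s| * ‖sqForm₁‖ + C * ‖sqForm₁‖ / (c * sqForm₂.1) * |s| * ‖sqForm₂‖ := by gcongr
    _ = _ := by ring

lemma IsEllipticRadial.exists_hessian_bound (hG : IsEllipticRadial G) (hr : 0 < r) (B : ℝ) :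
    ∃ C, ∀ w₁ ∈ eigenBox ℂ r R, ∀ w₂ ∈ eigenBox ℂ r R, G (radialPart w₁) = G (radialPart w₂) →
      ∀ β₁ β₂ : ℝ × ℂ, ‖β₂‖ ≤ B → radialFDeriv G w₁ β₁ = radialFDeriv G w₂ β₂ →
      ∀ η k m σ z : ℝ, 0 ≤ η → 0 ≤ k → |σ| ≤ 1 → |z| ≤ 1 →
      w₁ - w₂ = (-η) • sqForm₁ + m • sqForm₂ → ∀ Q : ℝ × ℂ, ‖Q.2‖ ≤ -Q.1 →
      Q = σ • (β₁ - β₂) - z • (w₁ - w₂) + k • sqForm₁ - (η * z) • (1, 0) → k ≤ C * η := by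
  obtain ⟨c, hc, lower⟩ := hG.exists_radialFDeriv_lower_bound (V := ℂ) (R := R) hr
  obtain ⟨C, upper⟩ := hG.exists_norm_radialFDeriv_le (V := ℂ) (R := R) hr
  obtain ⟨K, lipschitz⟩ := hG.exists_lipschitzOnWith_radialFDeriv (V := ℂ) (R := R) hr
  obtain ⟨M, hM⟩ := hG.exists_norm_sub_le (R := R) hr
  refine ⟨(K * M * B + C * M + C) / (c * sqForm₁.1), ?_⟩
  intro w₁ hw₁ w₂ hw₂ heq β₁ β₂ hβ₂ hβ η k m σ z hη hk hσ hz hsub Q hQ hQ_eq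
  have norm_sub : ‖w₁ - w₂‖ ≤ M * η := by
    simpa [abs_of_nonneg hη] using hM w₁ hw₁ w₂ hw₂ heq _ _ hsub
  set L := radialFDeriv G w₁
  have hC : 0 ≤ C := (norm_nonneg _).trans (upper w₁ hw₁)
  have third_order : |σ * L (β₁ - β₂)| ≤ K * (M * η) * B := by
    have : L (β₁ - β₂) = (radialFDeriv G w₂ - L) β₂ := by rw [map_sub, hβ]; rfl
    have lipschitz_sub : ‖radialFDeriv G w₂ - L‖ ≤ K * (M * η) := by
      rw [norm_sub_rev]
      exact (lipschitz.norm_sub_le hw₁ hw₂).trans (by gcongr)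
    rw [abs_mul, this]
    exact (mul_le_of_le_one_left (abs_nonneg _) hσ).trans
      ((radialFDeriv G w₂ - L).le_of_opNorm_le_of_le lipschitz_sub hβ₂)
  have second_order : |z * L (w₁ - w₂)| ≤ C * (M * η) := by
    rw [abs_mul]
    refine (mul_le_of_le_one_left (abs_nonneg _) hz).trans
      ((L.le_of_opNorm_le (upper w₁ hw₁) _).trans ?_)
    gcongr
  have axis : |η * z * L (1, 0)| ≤ C * η := by
    rw [mul_assoc, abs_mul, abs_of_nonneg hη, abs_mul, mul_comm]
    have : |L (1, 0)| ≤ C := by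
      simpa [Prod.norm_def] using L.le_of_opNorm_le (upper w₁ hw₁) (1, 0)
    gcongr
    exact (mul_le_of_le_one_left (abs_nonneg _) hz).trans this
  have nonpos : L Q ≤ 0 := by
    have := lower w₁ hw₁ (-Q) (by simpa using hQ)
    rw [map_neg, Prod.fst_neg] at this
    have := mul_nonneg hc.le ((norm_nonneg _).trans hQ)
    linarith
  have leading : k * (c * sqForm₁.1) ≤ k * L sqForm₁ := by
    gcongr
    exact lower w₁ hw₁ _ norm_snd_sqForm₁.le
  simp only [hQ_eq, map_add, map_sub L (_ + _), map_sub L (_ • _), map_smul, smul_eq_mul] at nonpos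
  rw [div_mul_eq_mul_div, le_div_iff₀ (mul_pos hc (by norm_num [sqForm₁]))]
  linarith [(abs_le.1 third_order).1, (abs_le.1 second_order).2, (abs_le.1 axis).2]

end Barrier

section MaximumPrinciple

variable {E : Type*} [NormedAddCommGroup E] [InnerProductSpace ℝ E]

/-- The eigenvalues of the derivative of `X` on the tangent planes of the unit sphere are positive.
If `X` is an inverse Gauss map, they are the principal radii of curvature. -/
def HasPositiveRadii (X : E → E) : Prop :=
  ∀ x a b, IsFrame x a b → planarForm (fderiv ℝ X x) a b ∈ positiveCone ℂ

/-- `X₁` and `X₂` have the same curvature function `G`, expressed through the half sum and half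
difference of the principal radii. -/
def HaveEqualCurvature (G : ℝ × ℝ → ℝ) (X₁ X₂ : E → E) : Prop :=
  ∀ x a b, IsFrame x a b → G (radialPart (planarForm (fderiv ℝ X₁ x) a b)) =
    G (radialPart (planarForm (fderiv ℝ X₂ x) a b))

lemma HaveEqualCurvature.symm {G : ℝ × ℝ → ℝ} {X₁ X₂ : E → E} (h : HaveEqualCurvature G X₁ X₂) :
    HaveEqualCurvature G X₂ X₁ := fun x a b hf => (h x a b hf).symm

lemma IsFrame.ne_zero {x a b : E} (h : IsFrame x a b) : x ≠ 0 :=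
  norm_ne_zero_iff.1 (h.norm_x.trans_ne one_ne_zero)

lemma isCompact_setOf_isFrame [ProperSpace E] :
    IsCompact {y : E × E × E | IsFrame y.1 y.2.1 y.2.2} := by
  have hsphere := isCompact_sphere (0 : E) 1
  have hset : {y : E × E × E | IsFrame y.1 y.2.1 y.2.2} =
      {y | ‖y.1‖ = 1 ∧ ‖y.2.1‖ = 1 ∧ ‖y.2.2‖ = 1 ∧ inner ℝ y.1 y.2.1 = 0 ∧
        inner ℝ y.1 y.2.2 = 0 ∧ inner ℝ y.2.1 y.2.2 = 0} :=
    Set.ext fun y => ⟨fun ⟨h₁, h₂, h₃, h₄, h₅, h₆⟩ => ⟨h₁, h₂, h₃, h₄, h₅, h₆⟩,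
      fun ⟨h₁, h₂, h₃, h₄, h₅, h₆⟩ => ⟨h₁, h₂, h₃, h₄, h₅, h₆⟩⟩
  refine (hsphere.prod (hsphere.prod hsphere)).of_isClosed_subset ?_
    fun y hy => by simpa using ⟨hy.norm_x, hy.norm_a, hy.norm_b⟩
  rw [hset]
  refine .and ?_ (.and ?_ (.and ?_ (.and ?_ (.and ?_ ?_)))) <;>
    exact isClosed_eq (by fun_prop) (by fun_prop)

namespace IsSupportGradient

variable {X X₁ X₂ : E → E} {p a b e : E}

lemma isCompact_planarForms [ProperSpace E] (h : IsSupportGradient X) :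
    IsCompact ((fun y : E × E × E => planarForm (fderiv ℝ X y.1) y.2.1 y.2.2) ''
      {y | IsFrame y.1 y.2.1 y.2.2}) := by
  have hcont : Continuous fun y : (E →L[ℝ] E) × E × E => planarForm y.1 y.2.1 y.2.2 := by
    unfold planarForm
    fun_prop
  refine isCompact_setOf_isFrame.image_of_continuousOn (hcont.comp_continuousOn
    (f := fun y : E × E × E => (fderiv ℝ X y.1, y.2)) ?_)
  exact (h.contDiffOn_fderiv.continuousOn.comp continuousOn_fst fun y hy => hy.ne_zero).prodMk
    continuousOn_snd

lemma exists_common_eigenBox [ProperSpace E] (h₁ : IsSupportGradient X₁)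
    (h₂ : IsSupportGradient X₂) (hpos₁ : HasPositiveRadii X₁) (hpos₂ : HasPositiveRadii X₂) :
    ∃ r > 0, ∃ R, ∀ x a b, IsFrame x a b → planarForm (fderiv ℝ X₁ x) a b ∈ eigenBox ℂ r R ∧
      planarForm (fderiv ℝ X₂ x) a b ∈ eigenBox ℂ r R := by
  obtain ⟨r, hr, R, hbox⟩ := exists_subset_eigenBox
    (h₁.isCompact_planarForms.union h₂.isCompact_planarForms) (by
      rintro _ (⟨y, hy, rfl⟩ | ⟨y, hy, rfl⟩)
      exacts [hpos₁ _ _ _ hy, hpos₂ _ _ _ hy])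
  exact ⟨r, hr, R, fun x a b hf => ⟨hbox (.inl ⟨(x, a, b), hf, rfl⟩),
    hbox (.inr ⟨(x, a, b), hf, rfl⟩)⟩⟩

lemma hasDerivAt_planarForm_greatCircle (h : IsSupportGradient X) (hf : IsFrame p a b) :
    HasDerivAt (fun s => planarForm (fderiv ℝ X (greatCircle p a s)) (greatCircle a (-p) s) b)
      (planarForm (fderiv ℝ (fderiv ℝ X) p a) a b) 0 := by
  have hvel : HasDerivAt (greatCircle a (-p)) (-p) 0 :=
    (hasDerivAt_greatCircle a (-p) 0).congr_deriv (by rw [greatCircle_zero])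
  refine (hasDerivAt_planarForm (h.hasDerivAt_fderiv_comp_greatCircle hf.ne_zero a) hvel ?_ ?_
    ).congr_deriv (by rw [greatCircle_zero])
  · rw [greatCircle_zero, map_neg, h.fderiv_self hf.ne_zero, neg_zero]
  · rw [greatCircle_zero, greatCircle_zero, inner_neg_right, h.inner_fderiv_self hf.ne_zero,
      neg_zero]

lemma radialFDeriv_planarForm_eq {G : ℝ × ℝ → ℝ} (hG : IsEllipticRadial G)
    (h₁ : IsSupportGradient X₁) (h₂ : IsSupportGradient X₂) (hpos₁ : HasPositiveRadii X₁)
    (hpos₂ : HasPositiveRadii X₂) (heq : HaveEqualCurvature G X₁ X₂) (hf : IsFrame p a b) :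
    radialFDeriv G (planarForm (fderiv ℝ X₁ p) a b) (planarForm (fderiv ℝ (fderiv ℝ X₁) p a) a b) =
      radialFDeriv G (planarForm (fderiv ℝ X₂ p) a b)
        (planarForm (fderiv ℝ (fderiv ℝ X₂) p a) a b) := by
  have along {X : E → E} (h : IsSupportGradient X) (hpos : HasPositiveRadii X) :
      HasDerivAt (fun s => G (radialPart (planarForm (fderiv ℝ X (greatCircle p a s))
        (greatCircle a (-p) s) b))) (radialFDeriv G (planarForm (fderiv ℝ X p) a b)
          (planarForm (fderiv ℝ (fderiv ℝ X) p a) a b)) 0 :=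
    (hG.hasFDerivAt_radial (hpos p a b hf)).comp_hasDerivAt_of_eq 0
      (h.hasDerivAt_planarForm_greatCircle hf) (by rw [greatCircle_zero, greatCircle_zero])
  refine (along h₁ hpos₁).unique ((along h₂ hpos₂).congr_of_eventuallyEq ?_)
  exact Filter.Eventually.of_forall fun s => heq _ _ _ (hf.greatCircle s)

lemma barrier_conditions (h : IsSupportGradient X) {φ φ' : ℝ → ℝ} {φ'' : ℝ}
    (hφ : ∀ t, HasDerivAt φ (φ' t) t) (hφ' : HasDerivAt φ' φ'' (inner ℝ p e)) (hp : ‖p‖ = 1)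
    (ha : ‖a‖ = 1) (hpa : inner ℝ p a = 0)
    (hmax : IsMaxOn (fun x => inner ℝ (X x) e + φ (inner ℝ x e)) (Metric.sphere 0 1) p) :
    inner ℝ (fderiv ℝ X p a) e + φ' (inner ℝ p e) * inner ℝ a e = 0 ∧
      inner ℝ (fderiv ℝ (fderiv ℝ X) p a a) e + φ'' * inner ℝ a e ^ 2
        - φ' (inner ℝ p e) * inner ℝ p e ≤ 0 := by
  have hp0 : p ≠ 0 := norm_ne_zero_iff.1 (hp.trans_ne one_ne_zero)
  have inner_circle (q c : E) (s : ℝ) : HasDerivAt (fun s => inner ℝ (greatCircle q c s) e)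
      (inner ℝ (greatCircle c (-q) s) e) s := by
    simpa using (hasDerivAt_greatCircle q c s).inner ℝ (hasDerivAt_const s e)
  have first (s : ℝ) : HasDerivAt
      (fun s => inner ℝ (X (greatCircle p a s)) e + φ (inner ℝ (greatCircle p a s) e))
      (inner ℝ (fderiv ℝ X (greatCircle p a s) (greatCircle a (-p) s)) e +
        φ' (inner ℝ (greatCircle p a s) e) * inner ℝ (greatCircle a (-p) s) e) s := by
    have hX := (h.hasDerivAt_comp_greatCircle hp ha hpa s).inner ℝ (hasDerivAt_const s e)
    exact (hX.add ((hφ _).comp s (inner_circle p a s))).congr_deriv (by simp)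
  have second : HasDerivAt
      (fun s => inner ℝ (fderiv ℝ X (greatCircle p a s) (greatCircle a (-p) s)) e +
        φ' (inner ℝ (greatCircle p a s) e) * inner ℝ (greatCircle a (-p) s) e)
      (inner ℝ (fderiv ℝ (fderiv ℝ X) p a a) e + φ'' * inner ℝ a e ^ 2
        - φ' (inner ℝ p e) * inner ℝ p e) 0 := by
    have hX := ((h.hasDerivAt_fderiv_comp_greatCircle hp0 a).clm_apply
      (hasDerivAt_greatCircle a (-p) 0)).inner ℝ (hasDerivAt_const 0 e)
    have hφ'_circle := hφ'.comp_of_eq (0 : ℝ) (inner_circle p a 0) (by rw [greatCircle_zero])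
    refine (hX.add (hφ'_circle.mul (inner_circle a (-p) 0))).congr_deriv ?_
    simp [h.fderiv_self hp0]
    ring
  have hlocal : IsLocalMax
      (fun s => inner ℝ (X (greatCircle p a s)) e + φ (inner ℝ (greatCircle p a s) e)) 0 :=
    Filter.Eventually.of_forall fun s => by
      simpa using hmax (mem_sphere_zero_iff_norm.2 (norm_greatCircle hp ha hpa s))
  exact ⟨by simpa using hlocal.hasDerivAt_eq_zero (first 0),
    second_deriv_nonpos_of_isLocalMax first second hlocal⟩

end IsSupportGradient

end MaximumPrinciple

section Pole

lemma evalForm_add (w w' : ℝ × ℂ) (s t : ℝ) :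
    evalForm (w + w') s t = evalForm w s t + evalForm w' s t := by
  simp [evalForm]
  ring

lemma evalForm_sub (w w' : ℝ × ℂ) (s t : ℝ) :
    evalForm (w - w') s t = evalForm w s t - evalForm w' s t := by
  simp [evalForm]
  ring

lemma evalForm_smul (c : ℝ) (w : ℝ × ℂ) (s t : ℝ) :
    evalForm (c • w) s t = c * evalForm w s t := by
  simp [evalForm]
  ring

lemma evalForm_sqForm₁ (s t : ℝ) : evalForm sqForm₁ s t = s ^ 2 := by
  simp [evalForm, sqForm₁]
  ring

namespace IsSupportGradient

variable {E : Type*} [NormedAddCommGroup E] [InnerProductSpace ℝ E] {X : E → E} {p a b : E}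

lemma inner_fderiv_comm (h : IsSupportGradient X) {x : E} (hx : x ≠ 0) (v u : E) :
    inner ℝ (fderiv ℝ X x v) u = inner ℝ (fderiv ℝ X x u) v := by
  rw [h.symm x hx, real_inner_comm]

lemma planarForm_eq_of_critical (h : IsSupportGradient X) (hf : IsFrame p a b) {z σ η : ℝ}
    (hσ : σ ≠ 0) (critical : ∀ v, ‖v‖ = 1 → inner ℝ p v = 0 →
      inner ℝ (fderiv ℝ X p v) (z • p + σ • a) + η * inner ℝ v (z • p + σ • a) = 0) :
    planarForm (fderiv ℝ X p) a b =
      (-η) • sqForm₁ + (inner ℝ (fderiv ℝ X p b) b : ℝ) • sqForm₂ := by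
  have haa := critical a hf.norm_a hf.inner_xa
  have hba := critical b hf.norm_b hf.inner_xb
  simp only [inner_add_right, real_inner_smul_right, h.inner_fderiv_self hf.ne_zero,
    real_inner_comm p a, real_inner_comm p b, real_inner_comm a b, hf.inner_xa, hf.inner_xb,
    hf.inner_ab, real_inner_self_eq_norm_sq a, hf.norm_a] at haa hba
  have form_aa : inner ℝ (fderiv ℝ X p a) a = -η :=
    eq_neg_of_add_eq_zero_left (mul_left_cancel₀ hσ (by linarith))
  have form_ab : inner ℝ (fderiv ℝ X p a) b = 0 := by
    rw [h.inner_fderiv_comm hf.ne_zero]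
    exact mul_left_cancel₀ hσ (by linarith)
  rw [planarForm, form_aa, form_ab]
  refine Prod.ext ?_ (Complex.ext ?_ ?_) <;> simp [sqForm₁, sqForm₂] <;> ring

lemma evalForm_hessian (h : IsSupportGradient X) (hf : IsFrame p a b) (z σ η k s t : ℝ) :
    evalForm (σ • planarForm (fderiv ℝ (fderiv ℝ X) p a) a b - z • planarForm (fderiv ℝ X p) a b +
        (k * σ ^ 2) • sqForm₁ - (η * z) • (1, 0)) s t =
      inner ℝ (fderiv ℝ (fderiv ℝ X) p (s • a + t • b) (s • a + t • b)) (z • p + σ • a) +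
        k * inner ℝ (s • a + t • b) (z • p + σ • a) ^ 2 - η * z * (s ^ 2 + t ^ 2) := by
  set v := s • a + t • b
  have hess_p : inner ℝ (fderiv ℝ (fderiv ℝ X) p v v) p = -inner ℝ (fderiv ℝ X p v) v := by
    rw [h.inner_fderiv_fderiv hf.ne_zero, h.fderiv_fderiv_apply_self hf.ne_zero, inner_neg_right,
      real_inner_comm]
  have hess_a : inner ℝ (fderiv ℝ (fderiv ℝ X) p v v) a =
      inner ℝ (fderiv ℝ (fderiv ℝ X) p a v) v := by
    rw [h.inner_fderiv_fderiv hf.ne_zero, h.fderiv_fderiv_comm hf.ne_zero, real_inner_comm]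
  have inner_v : inner ℝ v (z • p + σ • a) = s * σ := by
    simp [v, inner_add_left, inner_add_right, real_inner_smul_left, real_inner_smul_right,
      real_inner_comm p a, real_inner_comm p b, real_inner_comm a b, hf.inner_xa, hf.inner_xb,
      hf.inner_ab, hf.norm_a]
    ring
  rw [inner_add_right, real_inner_smul_right, real_inner_smul_right, hess_p, hess_a, inner_v,
    evalForm_sub, evalForm_add, evalForm_sub, evalForm_smul, evalForm_smul, evalForm_smul,
    evalForm_smul, evalForm_sqForm₁, evalForm_planarForm (h.inner_fderiv_comm hf.ne_zero b a),
    evalForm_planarForm (by rw [h.inner_fderiv_fderiv hf.ne_zero, real_inner_comm])]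
  simp only [evalForm, Complex.zero_re, Complex.zero_im]
  ring

end IsSupportGradient

variable {G : ℝ × ℝ → ℝ} {X₁ X₂ : Space3 → Space3}

lemma exists_barrier_bound (hG : IsEllipticRadial G) (h₁ : IsSupportGradient X₁)
    (h₂ : IsSupportGradient X₂) (hpos₁ : HasPositiveRadii X₁) (hpos₂ : HasPositiveRadii X₂)
    (heq : HaveEqualCurvature G X₁ X₂) :
    ∃ C, ∀ p e, ‖p‖ = 1 → ‖e‖ = 1 → inner ℝ p e ^ 2 < 1 → ∀ (φ φ' : ℝ → ℝ) (φ'' : ℝ),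
      (∀ t, HasDerivAt φ (φ' t) t) → HasDerivAt φ' φ'' (inner ℝ p e) →
      0 ≤ φ' (inner ℝ p e) → 0 ≤ φ'' →
      IsMaxOn (fun x => inner ℝ ((X₁ - X₂) x) e + φ (inner ℝ x e)) (Metric.sphere 0 1) p →
      φ'' * (1 - inner ℝ p e ^ 2) ≤ C * φ' (inner ℝ p e) := by
  obtain ⟨r, hr, R, hbox⟩ := h₁.exists_common_eigenBox h₂ hpos₁ hpos₂
  obtain ⟨D, hD⟩ := h₂.exists_norm_fderiv_fderiv_le
  obtain ⟨C, hC⟩ := hG.exists_hessian_bound (R := R) hr (2 * D)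
  refine ⟨C, fun p e hp he hpe φ φ' φ'' hφ hφ' hη hk hmax => ?_⟩
  have hX := h₁.sub h₂
  have hz := abs_real_inner_le_norm p e
  obtain ⟨a, b, σ, hσ, hf, hσ_sq, he_eq⟩ := exists_isFrame_of_sq_inner_lt_one hp he hpe
  rw [hp, he, one_mul] at hz
  have conditions (v : Space3) (hv : ‖v‖ = 1) (hpv : inner ℝ p v = 0) :=
    hX.barrier_conditions hφ hφ' hp hv hpv hmax
  set z := inner ℝ p e
  rw [he_eq] at conditions
  have first_order := hX.planarForm_eq_of_critical hf hσ.ne'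
    fun v hv hpv => (conditions v hv hpv).1
  have second_order := norm_snd_le_neg_fst fun s t hst => by
    rw [hX.evalForm_hessian hf z σ (φ' z) φ'', hst, mul_one]
    exact (conditions _ (hf.norm_comb hst) (hf.inner_comb s t)).2
  have hβ₂ : ‖planarForm (fderiv ℝ (fderiv ℝ X₂) p a) a b‖ ≤ 2 * D := by
    refine (norm_planarForm_le _ hf.norm_a hf.norm_b).trans
      (mul_le_mul_of_nonneg_left ?_ two_pos.le)
    simpa [hf.norm_a] using (fderiv ℝ (fderiv ℝ X₂) p).le_of_opNorm_le (hD p hp) a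
  rw [h₁.fderiv_sub h₂ hf.ne_zero, planarForm_sub] at first_order second_order
  rw [h₁.fderiv_fderiv_sub h₂ hf.ne_zero, sub_apply, planarForm_sub] at second_order
  rw [← hσ_sq]
  exact hC _ (hbox p a b hf).1 _ (hbox p a b hf).2 (heq p a b hf) _ _ hβ₂
    (IsSupportGradient.radialFDeriv_planarForm_eq hG h₁ h₂ hpos₁ hpos₂ heq hf) _ _ _ σ z hη
    (by positivity) (abs_le_one_iff_mul_self_le_one.2 (by nlinarith)) hz first_order _
    second_order rfl

lemma exists_isMaxOn_add_smul {α : Type*} [TopologicalSpace α] {S : Set α} (hS : IsCompact S)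
    (hS_closed : IsClosed S) {v ρ : α → ℝ} (hv : ContinuousOn v S) (hρ : ContinuousOn ρ S) {x₀ : α}
    (hx₀ : x₀ ∈ S) {μ : ℝ} (hμ : μ < v x₀) (hpos : ∀ y ∈ S, μ ≤ v y → 0 < ρ y) :
    ∃ δ > 0, ∀ ψ : α → ℝ, ContinuousOn ψ S → (∀ x, 0 ≤ ψ x) →
      ∃ ε > 0, ∃ p ∈ S, IsMaxOn (fun x => v x + ε * ψ x) S p ∧ δ ≤ ρ p := by
  have superlevel_compact : IsCompact (S ∩ v ⁻¹' Ici μ) :=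
    hS.of_isClosed_subset (hv.preimage_isClosed_of_isClosed hS_closed isClosed_Ici)
      inter_subset_left
  obtain ⟨y, hy, hy_min⟩ := superlevel_compact.exists_isMinOn ⟨x₀, hx₀, hμ.le⟩
    (hρ.mono inter_subset_left)
  refine ⟨ρ y, hpos y hy.1 hy.2, fun ψ hψ hψ_nonneg => ?_⟩
  obtain ⟨q, -, hq⟩ := hS.exists_isMaxOn ⟨x₀, hx₀⟩ hψ
  have hψq := hψ_nonneg q
  have hε : 0 < (v x₀ - μ) / (ψ q + 1) := div_pos (sub_pos.2 hμ) (by linarith)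
  set ε := (v x₀ - μ) / (ψ q + 1)
  obtain ⟨p, hp, hp_max⟩ := hS.exists_isMaxOn ⟨x₀, hx₀⟩ (hv.add (hψ.const_mul ε))
  refine ⟨ε, hε, p, hp, hp_max, hy_min ⟨hp, ?_⟩⟩
  have perturbation_le : ε * ψ p ≤ v x₀ - μ := calc
    ε * ψ p ≤ ε * (ψ q + 1) := by gcongr; linarith [show ψ p ≤ ψ q from hq hp]
    _ = v x₀ - μ := div_mul_cancel₀ _ (by linarith)
  have max_ge : v x₀ + ε * ψ x₀ ≤ v p + ε * ψ p := hp_max hx₀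
  have := mul_nonneg hε.le (hψ_nonneg x₀)
  simp only [mem_preimage, mem_Ici]
  linarith

lemma sq_inner_lt_one {E : Type*} [NormedAddCommGroup E] [InnerProductSpace ℝ E] {x e : E}
    (hx : ‖x‖ = 1) (he : ‖e‖ = 1) (hne : x ≠ e) (hne_neg : x ≠ -e) :
    inner ℝ x e ^ 2 < (1 : ℝ) := by
  rw [sq_lt_one_iff_abs_lt_one, abs_lt]
  constructor
  · rw [neg_lt, ← inner_neg_right]
    exact inner_lt_one_iff_real_of_norm_eq_one hx ((norm_neg e).trans he) |>.2 hne_neg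
  · exact inner_lt_one_iff_real_of_norm_eq_one hx he |>.2 hne

lemma inner_sub_le_max_pole (hG : IsEllipticRadial G) (h₁ : IsSupportGradient X₁)
    (h₂ : IsSupportGradient X₂) (hpos₁ : HasPositiveRadii X₁) (hpos₂ : HasPositiveRadii X₂)
    (heq : HaveEqualCurvature G X₁ X₂) {x₀ e : Space3} (hx₀ : ‖x₀‖ = 1) (he : ‖e‖ = 1) :
    inner ℝ ((X₁ - X₂) x₀) e ≤
      max (inner ℝ ((X₁ - X₂) e) e) (inner ℝ ((X₁ - X₂) (-e)) e) := by
  obtain ⟨C, hC⟩ := exists_barrier_bound hG h₁ h₂ hpos₁ hpos₂ heq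
  by_contra! hlt
  obtain ⟨μ, hμ, hμ'⟩ := exists_between hlt
  obtain ⟨δ, hδ, hδ_max⟩ := exists_isMaxOn_add_smul (isCompact_sphere (0 : Space3) 1)
    Metric.isClosed_sphere (v := fun x => inner ℝ ((X₁ - X₂) x) e)
    (ρ := fun x => 1 - inner ℝ x e ^ 2)
    (((h₁.sub h₂).contDiffOn.continuousOn.mono fun x hx => ne_zero_of_mem_unit_sphere ⟨x, hx⟩).inner
      continuousOn_const) (by fun_prop) (mem_sphere_zero_iff_norm.2 hx₀) hμ' fun y hy hyμ =>
        sub_pos.2 (sq_inner_lt_one (mem_sphere_zero_iff_norm.1 hy) he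
          (by rintro rfl; exact (((le_max_left _ _).trans_lt hμ).trans_le hyμ).false)
          (by rintro rfl; exact (((le_max_right _ _).trans_lt hμ).trans_le hyμ).false))
  set l := |C| / δ + 1
  obtain ⟨ε, hε, p, hp, hp_max, hδp⟩ :=
    hδ_max (fun x => Real.exp (l * inner ℝ x e)) (by fun_prop) fun x => (Real.exp_pos _).le
  have hexp (t : ℝ) : HasDerivAt (fun t => Real.exp (l * t)) (l * Real.exp (l * t)) t := by
    simpa [mul_comm] using ((hasDerivAt_id t).const_mul l).exp
  have hl : 0 < l := by positivity
  have bound := hC p e (mem_sphere_zero_iff_norm.1 hp) he (by linarith)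
    (fun t => ε * Real.exp (l * t)) _ _ (fun t => (hexp t).const_mul ε)
    (((hexp _).const_mul l).const_mul ε) (by positivity) (by positivity) hp_max
  have rate_le : l * (1 - inner ℝ p e ^ 2) ≤ C := by
    refine le_of_mul_le_mul_left ?_ (by positivity : 0 < ε * (l * Real.exp (l * inner ℝ p e)))
    linarith
  have rate_gt : |C| < l * δ := by
    rw [add_mul, one_mul, div_mul_cancel₀ _ hδ.ne']
    linarith
  linarith [mul_le_mul_of_nonneg_left hδp hl.le, le_abs_self C]

end Pole

section Rigidity

namespace IsSupportGradient

lemma fderiv_eq_smul_fderiv_normalize {E : Type*} [NormedAddCommGroup E] [InnerProductSpace ℝ E]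
    {X : E → E} {x : E} (h : IsSupportGradient X) (hx : x ≠ 0) :
    fderiv ℝ X x = ‖x‖⁻¹ • fderiv ℝ X (normalize x) :=
  (h.smul_fderiv_smul (inv_pos.2 (norm_pos_iff.2 hx)) x).symm

lemma exists_eq_const {E : Type*} [NormedAddCommGroup E] [InnerProductSpace ℝ E] {X : E → E}
    (hE : 1 < Module.rank ℝ E) (h : IsSupportGradient X)
    (hzero : ∀ x, ‖x‖ = 1 → fderiv ℝ X x = 0) : ∃ c, ∀ x ≠ 0, X x = c := by
  refine isOpen_compl_singleton.exists_is_const_of_fderiv_eq_zero (𝕜 := ℝ)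
    (isConnected_compl_singleton_of_one_lt_rank hE 0).isPreconnected
    (fun x hx => (h.hasFDerivAt hx).differentiableAt.differentiableWithinAt) fun x hx => ?_
  rw [h.fderiv_eq_smul_fderiv_normalize hx, hzero _ (NormedSpace.norm_normalize hx), smul_zero,
    Pi.zero_apply]

lemma fderiv_eq_zero_of_planarForm_eq_zero {X : Space3 → Space3} {x a b : Space3}
    (h : IsSupportGradient X) (hf : IsFrame x a b)
    (hzero : planarForm (fderiv ℝ X x) a b = 0) : fderiv ℝ X x = 0 := by
  obtain ⟨trace, entries⟩ := Prod.ext_iff.1 hzero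
  have diff : inner ℝ (fderiv ℝ X x a) a - inner ℝ (fderiv ℝ X x b) b = 0 := by
    simpa [planarForm] using congrArg Complex.re entries
  have form_ab : inner ℝ (fderiv ℝ X x a) b = 0 := by
    simpa [planarForm] using congrArg Complex.im entries
  simp only [planarForm, Prod.fst_zero] at trace
  have form_aa : inner ℝ (fderiv ℝ X x a) a = 0 := by linarith
  have form_bb : inner ℝ (fderiv ℝ X x b) b = 0 := by linarith
  have form_ba : inner ℝ (fderiv ℝ X x b) a = 0 := by
    rw [h.inner_fderiv_comm hf.ne_zero, form_ab]
  have map_tangent (u : Space3) (hu : inner ℝ a (fderiv ℝ X x u) = 0)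
      (hu' : inner ℝ b (fderiv ℝ X x u) = 0) : fderiv ℝ X x u = 0 := by
    have expand := hf.expand (d := fderiv ℝ X x u)
      (by rw [real_inner_comm, h.inner_fderiv_self hf.ne_zero])
    rwa [hu, hu', zero_smul, zero_smul, add_zero] at expand
  have map_a := map_tangent a (by rwa [real_inner_comm]) (by rwa [real_inner_comm])
  have map_b := map_tangent b (by rwa [real_inner_comm]) (by rwa [real_inner_comm])
  ext1 v
  have tangent : inner ℝ x (v - inner ℝ x v • x) = 0 := by
    simp [inner_sub_right, real_inner_smul_right, hf.norm_x]
  have := hf.expand tangent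
  rw [sub_eq_iff_eq_add] at this
  rw [this]
  simp [map_a, map_b, h.fderiv_self hf.ne_zero]

lemma inner_le_inner_self {E : Type*} [NormedAddCommGroup E] [InnerProductSpace ℝ E] {X : E → E}
    (h : IsSupportGradient X)
    (hsup : ∀ x e, ‖x‖ = 1 → ‖e‖ = 1 → inner ℝ (X x) e ≤ inner ℝ (X e) e) {x y : E}
    (hx : x ≠ 0) (hy : y ≠ 0) : inner ℝ (X x) y ≤ inner ℝ (X y) y := by
  have := hsup _ _ (NormedSpace.norm_normalize hx) (NormedSpace.norm_normalize hy)
  rw [h.map_normalize, h.map_normalize] at this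
  rw [← NormedSpace.norm_smul_normalize y, real_inner_smul_right, real_inner_smul_right,
    NormedSpace.norm_smul_normalize]
  gcongr

end IsSupportGradient

lemma inner_fderiv_self_nonneg_of_monotone {E : Type*} [NormedAddCommGroup E]
    [InnerProductSpace ℝ E] {X : E → E} {X' : E →L[ℝ] E} {x : E} (hX : HasFDerivAt X X' x)
    (hmono : ∀ᶠ y in 𝓝 x, 0 ≤ inner ℝ (X y - X x) (y - x)) (v : E) : 0 ≤ inner ℝ (X' v) v := by
  have line : HasDerivAt (fun t : ℝ => x + t • v) v 0 := by
    simpa using ((hasDerivAt_id (0 : ℝ)).smul_const v).const_add x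
  have along_line : HasDerivAt (fun t : ℝ => inner ℝ (X (x + t • v)) v) (inner ℝ (X' v) v) 0 := by
    simpa using (hX.comp_hasDerivAt_of_eq 0 line (by simp)).inner ℝ (hasDerivAt_const 0 v)
  refine ge_of_tendsto along_line.tendsto_slope_zero_right ?_
  have hline := line.continuousAt.tendsto.eventually (by simpa using hmono)
  filter_upwards [nhdsWithin_le_nhds hline, self_mem_nhdsWithin] with t ht htpos
  rw [add_sub_cancel_left, real_inner_smul_right] at ht
  rw [zero_add, zero_smul, add_zero, ← inner_sub_left]
  exact smul_nonneg (inv_nonneg.2 (le_of_lt htpos))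
    ((mul_nonneg_iff_of_pos_left htpos).1 ht)

variable {G : ℝ × ℝ → ℝ} {X₁ X₂ : Space3 → Space3}

lemma fderiv_sub_eq_zero_of_semidefinite (hG : IsEllipticRadial G) (h₁ : IsSupportGradient X₁)
    (h₂ : IsSupportGradient X₂) (hpos₁ : HasPositiveRadii X₁) (hpos₂ : HasPositiveRadii X₂)
    (heq : HaveEqualCurvature G X₁ X₂) {x a b : Space3} (hf : IsFrame x a b)
    (hle : ‖(planarForm (fderiv ℝ (X₁ - X₂) x) a b).2‖ ≤
      |(planarForm (fderiv ℝ (X₁ - X₂) x) a b).1|) : fderiv ℝ (X₁ - X₂) x = 0 := by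
  refine (h₁.sub h₂).fderiv_eq_zero_of_planarForm_eq_zero hf ?_
  rw [h₁.fderiv_sub h₂ hf.ne_zero, planarForm_sub] at hle ⊢
  rw [sub_eq_zero]
  rcases le_abs'.1 hle with h | h
  · rw [Prod.fst_sub, Prod.snd_sub, norm_sub_rev] at h
    exact (hG.eq_of_norm_sub_le (hpos₂ x a b hf) (hpos₁ x a b hf) (heq x a b hf).symm
      (by linarith)).symm
  · exact hG.eq_of_norm_sub_le (hpos₁ x a b hf) (hpos₂ x a b hf) (heq x a b hf) h

lemma one_lt_rank_space3 : 1 < Module.rank ℝ Space3 := by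
  rw [← Module.finrank_eq_rank, finrank_euclideanSpace_fin]
  norm_num

lemma exists_sub_eq_const_of_support (hG : IsEllipticRadial G) (h₁ : IsSupportGradient X₁)
    (h₂ : IsSupportGradient X₂) (hpos₁ : HasPositiveRadii X₁) (hpos₂ : HasPositiveRadii X₂)
    (heq : HaveEqualCurvature G X₁ X₂)
    (hsup : ∀ x e, ‖x‖ = 1 → ‖e‖ = 1 →
      inner ℝ ((X₁ - X₂) x) e ≤ inner ℝ ((X₁ - X₂) e) e) :
    ∃ c, ∀ x ≠ 0, (X₁ - X₂) x = c := by
  have hX := h₁.sub h₂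
  refine hX.exists_eq_const one_lt_rank_space3 fun x hx => ?_
  obtain ⟨a, ha, hxa⟩ := exists_unit_perp x
  obtain ⟨b, hf⟩ := exists_isFrame hx ha hxa
  have nonneg (v : Space3) : 0 ≤ inner ℝ (fderiv ℝ (X₁ - X₂) x v) v := by
    refine inner_fderiv_self_nonneg_of_monotone (hX.hasFDerivAt hf.ne_zero) ?_ v
    filter_upwards [isOpen_compl_singleton.mem_nhds hf.ne_zero] with y hy
    have at_y := hX.inner_le_inner_self hsup hf.ne_zero hy
    have at_x := hX.inner_le_inner_self hsup hy hf.ne_zero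
    simp only [inner_sub_left, inner_sub_right] at at_x at_y ⊢
    linarith
  refine fderiv_sub_eq_zero_of_semidefinite hG h₁ h₂ hpos₁ hpos₂ heq hf
    (le_trans ?_ (le_abs_self _))
  obtain ⟨s, t, -, least⟩ := exists_evalForm_eq_sub (planarForm (fderiv ℝ (X₁ - X₂) x) a b)
  rw [evalForm_planarForm (hX.inner_fderiv_comm hf.ne_zero b a)] at least
  linarith [nonneg (s • a + t • b)]

lemma inner_fderiv_eq_zero_of_inner_const {X : Space3 → Space3} (h : IsSupportGradient X)
    {e x : Space3} {c : ℝ} (hconst : ∀ y, ‖y‖ = 1 → inner ℝ (X y) e = c) (hx : x ≠ 0)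
    (v : Space3) : inner ℝ (fderiv ℝ X x v) e = 0 := by
  have eventually_const : (fun y => inner ℝ (X y) e) =ᶠ[𝓝 x] fun _ => c := by
    filter_upwards [isOpen_compl_singleton.mem_nhds hx] with y hy
    rw [← h.map_normalize, hconst _ (NormedSpace.norm_normalize hy)]
  simpa using DFunLike.congr_fun (((h.hasFDerivAt hx).inner ℝ (hasFDerivAt_const e x)).unique
    ((hasFDerivAt_const c x).congr_of_eventuallyEq eventually_const)) v

lemma fderiv_sub_eq_zero_of_inner_const (hG : IsEllipticRadial G) (h₁ : IsSupportGradient X₁)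
    (h₂ : IsSupportGradient X₂) (hpos₁ : HasPositiveRadii X₁) (hpos₂ : HasPositiveRadii X₂)
    (heq : HaveEqualCurvature G X₁ X₂) {e x : Space3} {c : ℝ} (he : ‖e‖ = 1)
    (hconst : ∀ y, ‖y‖ = 1 → inner ℝ ((X₁ - X₂) y) e = c) (hx : ‖x‖ = 1)
    (hxe : inner ℝ x e ^ 2 < 1) : fderiv ℝ (X₁ - X₂) x = 0 := by
  have hX := h₁.sub h₂
  obtain ⟨a, b, σ, hσ, hf, -, he_eq⟩ := exists_isFrame_of_sq_inner_lt_one hx he hxe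
  have form_a (v : Space3) : inner ℝ (fderiv ℝ (X₁ - X₂) x v) a = 0 := by
    have := inner_fderiv_eq_zero_of_inner_const hX hconst hf.ne_zero v
    rw [he_eq, inner_add_right, real_inner_smul_right, real_inner_smul_right,
      hX.inner_fderiv_self hf.ne_zero, mul_zero, zero_add] at this
    exact (mul_eq_zero.1 this).resolve_left hσ.ne'
  have form_ab : inner ℝ (fderiv ℝ (X₁ - X₂) x a) b = 0 := by
    rw [hX.inner_fderiv_comm hf.ne_zero, form_a]
  refine fderiv_sub_eq_zero_of_semidefinite hG h₁ h₂ hpos₁ hpos₂ heq hf (le_of_eq ?_)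
  simp [planarForm, form_a, form_ab, abs_div]

lemma exists_sub_eq_const_of_inner_const (hG : IsEllipticRadial G) (h₁ : IsSupportGradient X₁)
    (h₂ : IsSupportGradient X₂) (hpos₁ : HasPositiveRadii X₁) (hpos₂ : HasPositiveRadii X₂)
    (heq : HaveEqualCurvature G X₁ X₂) {e : Space3} {c : ℝ} (he : ‖e‖ = 1)
    (hconst : ∀ y, ‖y‖ = 1 → inner ℝ ((X₁ - X₂) y) e = c) :
    ∃ c, ∀ x ≠ 0, (X₁ - X₂) x = c := by
  have hX := h₁.sub h₂
  have zero_off_axis : EqOn (fderiv ℝ (X₁ - X₂)) 0 (Submodule.span ℝ {e} : Set Space3)ᶜ := by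
    intro x hx
    have hx0 : x ≠ 0 := fun h0 => hx (h0 ▸ zero_mem _)
    have normalize_ne {u : Space3} (hu : u ∈ Submodule.span ℝ {e}) : normalize x ≠ u := fun h =>
      hx (by rw [← NormedSpace.norm_smul_normalize x, h]; exact Submodule.smul_mem _ _ hu)
    have he_mem := Submodule.mem_span_singleton_self (R := ℝ) e
    have hx1 := NormedSpace.norm_normalize hx0
    rw [hX.fderiv_eq_smul_fderiv_normalize hx0, fderiv_sub_eq_zero_of_inner_const hG h₁ h₂ hpos₁
      hpos₂ heq he hconst hx1 (sq_inner_lt_one hx1 he (normalize_ne he_mem)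
        (normalize_ne (neg_mem he_mem))), smul_zero, Pi.zero_apply]
  have axis_ne_top : Submodule.span ℝ {e} ≠ ⊤ := by
    simpa using span_ne_top_of_card_lt {e} (by simp)
  have dense_off_axis : Dense (Submodule.span ℝ {e} : Set Space3)ᶜ :=
    interior_eq_empty_iff_dense_compl.1 <| not_nonempty_iff_eq_empty.1 fun h =>
      axis_ne_top (Submodule.eq_top_of_nonempty_interior' _ h)
  have zero : EqOn (fderiv ℝ (X₁ - X₂)) 0 {0}ᶜ :=
    zero_off_axis.of_subset_closure hX.contDiffOn_fderiv.continuousOn continuousOn_const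
      (compl_subset_compl.2 (singleton_subset_iff.2 (zero_mem _)))
      (dense_off_axis.closure_eq ▸ subset_univ _)
  exact hX.exists_eq_const one_lt_rank_space3 fun x hx =>
    zero (norm_ne_zero_iff.1 (hx.trans_ne one_ne_zero))

lemma forall_pos_or_forall_neg {α : Type*} [TopologicalSpace α] {S : Set α} (hS : IsPreconnected S)
    {k : α → ℝ} (hk : ContinuousOn k S) (hne : ∀ x ∈ S, k x ≠ 0) :
    (∀ x ∈ S, 0 < k x) ∨ ∀ x ∈ S, k x < 0 := by
  by_contra! h
  obtain ⟨⟨x, hx, hkx⟩, y, hy, hky⟩ := h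
  obtain ⟨z, hz, hkz⟩ := hS.intermediate_value hx hy hk ⟨hkx, hky⟩
  exact hne z hz hkz

/-- The difference of the heights over the pole `e` and its antipode in the direction `e`. -/
noncomputable def poleGap {E : Type*} [NormedAddCommGroup E] [InnerProductSpace ℝ E] (X : E → E)
    (e : E) : ℝ :=
  inner ℝ (X e) e - inner ℝ (X (-e)) e

lemma poleGap_neg {E : Type*} [NormedAddCommGroup E] [InnerProductSpace ℝ E] (X : E → E) (e : E) :
    poleGap X (-e) = poleGap X e := by
  simp only [poleGap, neg_neg, inner_neg_right]
  ring

lemma IsSupportGradient.continuousOn_poleGap {E : Type*} [NormedAddCommGroup E]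
    [InnerProductSpace ℝ E] {X : E → E} (h : IsSupportGradient X) :
    ContinuousOn (poleGap X) {0}ᶜ :=
  (h.contDiffOn.continuousOn.inner continuousOn_id).sub
    ((h.contDiffOn.continuousOn.comp continuousOn_neg fun _ hx => neg_ne_zero.2 hx).inner
      continuousOn_id)

theorem exists_sub_eq_const (hG : IsEllipticRadial G) (h₁ : IsSupportGradient X₁)
    (h₂ : IsSupportGradient X₂) (hpos₁ : HasPositiveRadii X₁) (hpos₂ : HasPositiveRadii X₂)
    (heq : HaveEqualCurvature G X₁ X₂) : ∃ c, ∀ x ≠ 0, (X₁ - X₂) x = c := by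
  have le_max_pole {x e : Space3} (hx : ‖x‖ = 1) (he : ‖e‖ = 1) :=
    inner_sub_le_max_pole hG h₁ h₂ hpos₁ hpos₂ heq hx he
  by_cases! hgap : ∃ e, ‖e‖ = 1 ∧ poleGap (X₁ - X₂) e = 0
  · obtain ⟨e, he, hgap⟩ := hgap
    rw [poleGap, sub_eq_zero] at hgap
    refine exists_sub_eq_const_of_inner_const hG h₁ h₂ hpos₁ hpos₂ heq he
      (c := inner ℝ ((X₁ - X₂) e) e) fun x hx => le_antisymm ?_ ?_
    · exact (le_max_pole hx he).trans_eq (by rw [← hgap, max_self])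
    · have := le_max_pole hx ((norm_neg e).trans he)
      rw [neg_neg, inner_neg_right, inner_neg_right, inner_neg_right, ← hgap, max_self] at this
      exact neg_le_neg_iff.1 this
  have hsphere := isPreconnected_sphere one_lt_rank_space3 0 1
  rcases forall_pos_or_forall_neg hsphere ((h₁.sub h₂).continuousOn_poleGap.mono
    fun x hx => ne_zero_of_mem_unit_sphere ⟨x, hx⟩) (by simpa using hgap) with hpos | hneg
  · refine exists_sub_eq_const_of_support hG h₁ h₂ hpos₁ hpos₂ heq fun x e hx he => ?_
    have := hpos e (mem_sphere_zero_iff_norm.2 he)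
    exact (le_max_pole hx he).trans_eq (max_eq_left (sub_pos.1 this).le)
  · obtain ⟨c, hc⟩ := exists_sub_eq_const_of_support hG h₂ h₁ hpos₂ hpos₁ heq.symm
      fun x e hx he => by
        have := hneg e (mem_sphere_zero_iff_norm.2 he)
        rw [← poleGap_neg, poleGap, neg_neg] at this
        have le_max := le_max_pole hx ((norm_neg e).trans he)
        rw [neg_neg, max_eq_right (sub_neg.1 this).le] at le_max
        simpa only [← neg_sub X₁ X₂, Pi.neg_apply, inner_neg_left, inner_neg_right] using le_max
    exact ⟨-c, fun x hx => by rw [← hc x hx, ← Pi.neg_apply, neg_sub]⟩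

end Rigidity

section SupportingNormals

section ConvexBody

variable {E : Type*} [NormedAddCommGroup E] [InnerProductSpace ℝ E] {M K : Set E} {p q n o : E}

/-- `n` is a unit vector and `M` lies in the half-space `⟪y - p, n⟫ ≤ 0`. -/
def IsSupportingNormal (M : Set E) (p n : E) : Prop :=
  ‖n‖ = 1 ∧ ∀ y ∈ M, inner ℝ (y - p) n ≤ 0

namespace IsSupportingNormal

lemma inner_sub_eq_zero (hp : p ∈ M) (hq : q ∈ M) (hpn : IsSupportingNormal M p n)
    (hqn : IsSupportingNormal M q n) : inner ℝ (q - p) n = 0 := by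
  have hle := hqn.2 p hp
  rw [← neg_sub, inner_neg_left] at hle
  linarith [hpn.2 q hq]

lemma of_inner_sub_eq_zero (hpn : IsSupportingNormal M p n) (hpq : inner ℝ (q - p) n = 0) :
    IsSupportingNormal M q n := by
  refine ⟨hpn.1, fun y hy => ?_⟩
  rw [← sub_sub_sub_cancel_right y q p, inner_sub_left, hpq, sub_zero]
  exact hpn.2 y hy

lemma inner_sub_neg_of_mem_interior (hn : IsSupportingNormal K p n) (ho : o ∈ interior K) :
    inner ℝ (o - p) n < 0 := by
  obtain ⟨δ, hδ, hball⟩ := Metric.mem_nhds_iff.1 (mem_interior_iff_mem_nhds.1 ho)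
  have pushed_mem : o + (δ / 2) • n ∈ K := hball <| by
    rw [Metric.mem_ball, dist_self_add_left, norm_smul, hn.1, mul_one,
      Real.norm_of_nonneg (by positivity)]
    exact half_lt_self hδ
  have pushed := hn.2 _ pushed_mem
  rw [add_sub_right_comm, inner_add_left, real_inner_smul_left, real_inner_self_eq_norm_sq, hn.1]
    at pushed
  linarith

lemma mem_frontier (hn : IsSupportingNormal K p n) (hp : p ∈ closure K) : p ∈ frontier K :=
  ⟨hp, fun hint => by simpa using hn.inner_sub_neg_of_mem_interior hint⟩

end IsSupportingNormal

lemma exists_isSupportingNormal_of_norm_eq_one (hK : IsCompact K) (hne : K.Nonempty)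
    (hn : ‖n‖ = 1) : ∃ q ∈ frontier K, IsSupportingNormal K q n := by
  obtain ⟨q, hq, hmax⟩ := hK.exists_isMaxOn hne (f := fun y : E => inner ℝ y n) (by fun_prop)
  have hqn : IsSupportingNormal K q n :=
    ⟨hn, fun y hy => by rw [inner_sub_left]; exact sub_nonpos.2 (hmax hy)⟩
  exact ⟨q, hqn.mem_frontier (subset_closure hq), hqn⟩

lemma isSupportingNormal_frontier_iff (hK : IsCompact K) (hne : K.Nonempty) :
    IsSupportingNormal (frontier K) p n ↔ IsSupportingNormal K p n := by
  refine ⟨fun hn => ⟨hn.1, fun y hy => ?_⟩,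
    fun hn => ⟨hn.1, fun y hy => hn.2 y (hK.isClosed.frontier_subset hy)⟩⟩
  obtain ⟨q, hq, hqn⟩ := exists_isSupportingNormal_of_norm_eq_one hK hne hn.1
  rw [← sub_add_sub_cancel y q p, inner_add_left]
  exact add_nonpos (hqn.2 y hy) (hn.2 q hq)

lemma exists_isSupportingNormal_of_mem_frontier [CompleteSpace E] (hK : Convex ℝ K)
    (hne : (interior K).Nonempty) (hp : p ∈ frontier K) : ∃ n, IsSupportingNormal K p n := by
  obtain ⟨f, hf⟩ := geometric_hahn_banach_open_point hK.interior isOpen_interior hp.2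
  obtain ⟨m, rfl⟩ := (InnerProductSpace.toDual ℝ E).surjective f
  simp only [InnerProductSpace.toDual_apply_apply] at hf
  obtain ⟨o, ho⟩ := hne
  have hm : m ≠ 0 := by
    rintro rfl
    simpa using hf o ho
  have half_space : closure (interior K) ⊆ {y | inner ℝ m y ≤ inner ℝ m p} :=
    closure_minimal (fun y hy => (hf y hy).le) (isClosed_le (by fun_prop) continuous_const)
  rw [hK.closure_interior_eq_closure_of_nonempty_interior ⟨o, ho⟩] at half_space
  refine ⟨normalize m, NormedSpace.norm_normalize_eq_one_iff.2 hm, fun y hy => ?_⟩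
  rw [NormedSpace.normalize, real_inner_smul_right, real_inner_comm, inner_sub_right]
  exact mul_nonpos_of_nonneg_of_nonpos (by positivity)
    (sub_nonpos.2 (half_space (subset_closure hy)))

end ConvexBody

namespace IsClosedConvexSurface

variable {M : Set Space3} {p q n : Space3}

lemma exists_isSupportingNormal (hM : IsClosedConvexSurface M) (hp : p ∈ M) :
    ∃ n, IsSupportingNormal M p n := by
  obtain ⟨K, hK, hconv, hne, rfl⟩ := hM
  obtain ⟨n, hn⟩ := exists_isSupportingNormal_of_mem_frontier hconv hne hp
  exact ⟨n, (isSupportingNormal_frontier_iff hK (hne.mono interior_subset)).2 hn⟩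

lemma exists_mem_isSupportingNormal (hM : IsClosedConvexSurface M) (hn : ‖n‖ = 1) :
    ∃ p ∈ M, IsSupportingNormal M p n := by
  obtain ⟨K, hK, -, hne, rfl⟩ := hM
  have hK₀ := hne.mono interior_subset
  obtain ⟨q, hq, hqn⟩ := exists_isSupportingNormal_of_norm_eq_one hK hK₀ hn
  exact ⟨q, hq, (isSupportingNormal_frontier_iff hK hK₀).2 hqn⟩

lemma exists_inner_sub_neg (hM : IsClosedConvexSurface M) :
    ∃ o, ∀ p n, IsSupportingNormal M p n → inner ℝ (o - p) n < 0 := by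
  obtain ⟨K, hK, -, ⟨o, ho⟩, rfl⟩ := hM
  exact ⟨o, fun p n hn => ((isSupportingNormal_frontier_iff hK ⟨o, interior_subset ho⟩).1
    hn).inner_sub_neg_of_mem_interior ho⟩

lemma isSupportingNormal_of_mem_segment (hM : IsClosedConvexSurface M) (hp : p ∈ M) (hq : q ∈ M)
    (hpn : IsSupportingNormal M p n) (hqn : IsSupportingNormal M q n) :
    ∀ y ∈ segment ℝ p q, y ∈ M ∧ IsSupportingNormal M y n := by
  have hpq := IsSupportingNormal.inner_sub_eq_zero hp hq hpn hqn
  obtain ⟨K, hK, hconv, -, rfl⟩ := hM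
  have hsub := hK.isClosed.frontier_subset
  intro y hy
  have hyn : IsSupportingNormal (frontier K) y n := by
    obtain ⟨t, -, rfl⟩ := (segment_eq_image' ℝ p q).subset hy
    refine hpn.of_inner_sub_eq_zero ?_
    rw [add_sub_cancel_left, real_inner_smul_left, hpq, mul_zero]
  have hyK : y ∈ K := hconv.segment_subset (hsub hp) (hsub hq) hy
  exact ⟨((isSupportingNormal_frontier_iff hK ⟨y, hyK⟩).1 hyn).mem_frontier
    (subset_closure hyK), hyn⟩

end IsClosedConvexSurface

end SupportingNormals

section GaussMap

lemma tangentConeAt_levelSet {E F : Type*} [NormedAddCommGroup E] [NormedSpace ℝ E]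
    [CompleteSpace E] [NormedAddCommGroup F] [NormedSpace ℝ F] [FiniteDimensional ℝ F] {f : E → F}
    {f' : E →L[ℝ] F} {a : E} (hf : HasStrictFDerivAt f f' a) (hf' : f'.range = ⊤) :
    tangentConeAt ℝ {x | f x = f a} a = f'.ker := by
  ext v
  constructor
  · have hconst : HasFDerivWithinAt f (0 : E →L[ℝ] F) {x | f x = f a} a :=
      (hasFDerivWithinAt_const (f a) a _).congr (fun _ hx => hx) rfl
    exact fun hv => hf.hasFDerivAt.hasFDerivWithinAt.unique_on hconst hv
  · intro hv
    set curve : ℝ → E := fun s => hf.implicitFunction f f' hf' (f a) (s • ⟨v, hv⟩)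
    have curve_zero : curve 0 = a := by
      simp only [curve, zero_smul, hf.implicitFunction_apply_image hf']
    have hcurve : HasDerivAt curve v 0 := by
      have himplicit := (hf.to_implicitFunction hf').hasFDerivAt
      have hline : HasDerivAt (fun s : ℝ => s • (⟨v, hv⟩ : f'.ker)) ⟨v, hv⟩ 0 := by
        simpa using (hasDerivAt_id (0 : ℝ)).smul_const (⟨v, hv⟩ : f'.ker)
      rw [← zero_smul ℝ (⟨v, hv⟩ : f'.ker)] at himplicit
      exact himplicit.comp_hasDerivAt (0 : ℝ) hline
    have curve_mem : ∀ᶠ s in 𝓝 (0 : ℝ), f (curve s) = f a := by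
      have hline : Continuous fun s : ℝ => (f a, s • (⟨v, hv⟩ : f'.ker)) := by fun_prop
      exact (hline.tendsto' 0 (f a, 0) (by simp)).eventually (hf.map_implicitFunction_eq hf')
    refine mem_tangentConeAt_of_seq (𝓝[≠] (0 : ℝ)) (fun s => s⁻¹) (fun s => curve s - a) ?_ ?_ ?_
    · have hlim := hcurve.continuousAt.tendsto.sub_const a
      rw [curve_zero, sub_self] at hlim
      exact hlim.mono_left nhdsWithin_le_nhds
    · filter_upwards [nhdsWithin_le_nhds curve_mem] with s hs
      rwa [add_sub_cancel]
    · refine hcurve.tendsto_slope.congr fun s => ?_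
      rw [slope_def_module, sub_zero, curve_zero]

/-- `g` is a `C^k` function without critical points on the open set `V`, in which it cuts out `M`:
the data in the definition of a regular surface. -/
structure IsDefiningFunction (k : WithTop ℕ∞) (M V : Set Space3) (g : Space3 → ℝ) : Prop where
  isOpen : IsOpen V
  contDiffOn : ContDiffOn ℝ k g V
  fderiv_ne_zero : ∀ x ∈ V, fderiv ℝ g x ≠ 0
  inter_eq : M ∩ V = {x ∈ V | g x = 0}

namespace IsDefiningFunction

variable {k : WithTop ℕ∞} {M V : Set Space3} {g : Space3 → ℝ} {p n : Space3}

lemma mem_iff (h : IsDefiningFunction k M V g) (hp : p ∈ V) : p ∈ M ↔ g p = 0 := by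
  simpa only [mem_inter_iff, mem_ofPred_eq, hp, and_true, true_and] using
    Set.ext_iff.1 h.inter_eq p

lemma hasStrictFDerivAt (h : IsDefiningFunction k M V g) (hk : k ≠ 0) (hp : p ∈ V) :
    HasStrictFDerivAt g (fderiv ℝ g p) p :=
  (h.contDiffOn.contDiffAt (h.isOpen.mem_nhds hp)).hasStrictFDerivAt hk

lemma gradient_ne_zero (h : IsDefiningFunction k M V g) (hp : p ∈ V) : gradient g p ≠ 0 := by
  rw [gradient, map_ne_zero_iff _ (LinearIsometryEquiv.injective _)]
  exact h.fderiv_ne_zero p hp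

lemma neg (h : IsDefiningFunction k M V g) : IsDefiningFunction k M V (-g) where
  isOpen := h.isOpen
  contDiffOn := h.contDiffOn.neg
  fderiv_ne_zero x hx := by
    rw [fderiv_neg]
    exact neg_ne_zero.2 (h.fderiv_ne_zero x hx)
  inter_eq := by simpa using h.inter_eq

lemma mono (h : IsDefiningFunction k M V g) {U : Set Space3} (hU : IsOpen U) (hUV : U ⊆ V) :
    IsDefiningFunction k M U g where
  isOpen := hU
  contDiffOn := h.contDiffOn.mono hUV
  fderiv_ne_zero x hx := h.fderiv_ne_zero x (hUV hx)
  inter_eq := by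
    ext x
    exact ⟨fun hx => ⟨hx.2, (h.mem_iff (hUV hx.2)).1 hx.1⟩,
      fun hx => ⟨(h.mem_iff (hUV hx.1)).2 hx.2, hx.1⟩⟩

lemma eventually_mem_iff (h : IsDefiningFunction k M V g) (hp : p ∈ M) (hpV : p ∈ V) :
    M =ᶠ[𝓝 p] {x | g x = g p} := by
  filter_upwards [h.isOpen.mem_nhds hpV] with x hx
  rw [(h.mem_iff hpV).1 hp]
  exact propext (h.mem_iff hx)

lemma mem_tangentConeAt_iff (h : IsDefiningFunction k M V g) (hk : k ≠ 0) (hp : p ∈ M)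
    (hpV : p ∈ V) {v : Space3} : v ∈ tangentConeAt ℝ M p ↔ fderiv ℝ g p v = 0 := by
  have hrange : (fderiv ℝ g p).range = ⊤ := LinearMap.range_eq_top.2 <|
    LinearMap.surjective fun hzero => h.fderiv_ne_zero p hpV (by ext v; exact congr($hzero v))
  rw [tangentConeAt_congr (nhdsWithin_eq_iff_eventuallyEq.2 (h.eventually_mem_iff hp hpV)),
    tangentConeAt_levelSet (h.hasStrictFDerivAt hk hpV) hrange]
  rfl

/- By Lagrange multipliers, as `p` maximizes `⟪·, n⟫` on `M`. -/
lemma exists_eq_smul_gradient (h : IsDefiningFunction k M V g) (hk : k ≠ 0) (hp : p ∈ M)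
    (hpV : p ∈ V) (hn : IsSupportingNormal M p n) : ∃ c : ℝ, n = c • gradient g p := by
  have hextr : IsLocalExtrOn (innerSL ℝ n) {x | g x = g p} p := by
    refine Or.inr ?_
    filter_upwards [nhdsWithin_le_nhds (h.eventually_mem_iff hp hpV), self_mem_nhdsWithin]
      with y hyM hy
    have hle := hn.2 y (hyM.mpr hy)
    rw [inner_sub_left, real_inner_comm, real_inner_comm n p] at hle
    exact sub_nonpos.1 hle
  obtain ⟨a, b, hab, hmult⟩ := hextr.exists_multipliers_of_hasStrictFDerivAt_1d
    (h.hasStrictFDerivAt hk hpV) (innerSL ℝ n).hasStrictFDerivAt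
  have hmult' : a • gradient g p + b • n = 0 := ext_inner_right ℝ fun v => by
    simpa [inner_add_left, real_inner_smul_left, inner_gradient_left] using congr($hmult v)
  have hb : b ≠ 0 := by
    rintro rfl
    rw [zero_smul, add_zero, smul_eq_zero] at hmult'
    exact hab (by rw [hmult'.resolve_right (h.gradient_ne_zero hpV)]; rfl)
  refine ⟨-(b⁻¹ * a), ?_⟩
  rw [← inv_smul_smul₀ hb n, eq_neg_of_add_eq_zero_right hmult', smul_neg, smul_smul, neg_smul]

lemma isOuterUnitNormal_iff (h : IsDefiningFunction k M V g) (hk : k ≠ 0) (hp : p ∈ M)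
    (hpV : p ∈ V) : IsOuterUnitNormal M p n ↔ IsSupportingNormal M p n := by
  refine ⟨fun hn => ⟨hn.1, hn.2.2⟩, fun hn => ⟨hn.1, fun v hv => ?_, hn.2⟩⟩
  obtain ⟨c, rfl⟩ := h.exists_eq_smul_gradient hk hp hpV hn
  rw [real_inner_smul_right, real_inner_comm, inner_gradient_left,
    (h.mem_tangentConeAt_iff hk hp hpV).1 hv, mul_zero]

lemma eq_normalize_gradient (h : IsDefiningFunction k M V g) (hk : k ≠ 0) (hp : p ∈ M)
    (hpV : p ∈ V) (hn : IsSupportingNormal M p n) {o : Space3} (hon : inner ℝ (o - p) n < 0)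
    (hog : fderiv ℝ g p (o - p) < 0) : n = normalize (gradient g p) := by
  obtain ⟨c, rfl⟩ := h.exists_eq_smul_gradient hk hp hpV hn
  rw [real_inner_smul_right, real_inner_comm, inner_gradient_left] at hon
  rw [← NormedSpace.normalize_eq_self_of_norm_eq_one hn.1,
    NormedSpace.normalize_smul_of_pos (by_contra fun hc => by nlinarith)]

end IsDefiningFunction

/-- A defining function which increases towards the exterior of the convex surface `M`, so that its
normalized gradient extends the Gauss map. -/
structure IsOutwardDefiningFunction (k : WithTop ℕ∞) (M V : Set Space3) (g : Space3 → ℝ) : Prop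
    extends IsDefiningFunction k M V g where
  gaussMap_eq : ∀ p ∈ M, p ∈ V → gaussMap M p = normalize (gradient g p)

lemma IsRegularSurface.exists_isDefiningFunction {k : WithTop ℕ∞} {M : Set Space3} {p : Space3}
    (hM : IsRegularSurface k M) (hp : p ∈ M) : ∃ V g, p ∈ V ∧ IsDefiningFunction k M V g := by
  obtain ⟨V, g, hV, hpV, hg, hg0, hMV⟩ := hM p hp
  exact ⟨V, g, hpV, hV, hg, hg0, hMV⟩

namespace IsClosedConvexSurface

variable {k : WithTop ℕ∞} {M : Set Space3} {p n : Space3}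

lemma isSupportingNormal_gaussMap (hM : IsClosedConvexSurface M) (hreg : IsRegularSurface k M)
    (hk : k ≠ 0) (hp : p ∈ M) : IsSupportingNormal M p (gaussMap M p) := by
  obtain ⟨V, g, hpV, hg⟩ := hreg.exists_isDefiningFunction hp
  have hex : ∃ n, IsOuterUnitNormal M p n := by
    simpa only [hg.isOuterUnitNormal_iff hk hp hpV] using hM.exists_isSupportingNormal hp
  rw [← hg.isOuterUnitNormal_iff hk hp hpV, gaussMap, dif_pos hex]
  exact hex.choose_spec

lemma exists_decreasing_isDefiningFunction (hM : IsClosedConvexSurface M)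
    (hreg : IsRegularSurface k M) (hk : k ≠ 0) (hp : p ∈ M) {o : Space3}
    (ho : ∀ p n, IsSupportingNormal M p n → inner ℝ (o - p) n < 0) :
    ∃ V g, p ∈ V ∧ IsDefiningFunction k M V g ∧ ∀ y ∈ V, fderiv ℝ g y (o - y) < 0 := by
  obtain ⟨U, g, hpU, hgU, hgp⟩ :
      ∃ U g, p ∈ U ∧ IsDefiningFunction k M U g ∧ fderiv ℝ g p (o - p) < 0 := by
    obtain ⟨U, g, hpU, hg⟩ := hreg.exists_isDefiningFunction hp
    obtain ⟨n, hn⟩ := hM.exists_isSupportingNormal hp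
    have hne : fderiv ℝ g p (o - p) ≠ 0 := fun hzero => by
      obtain ⟨c, hc⟩ := hg.exists_eq_smul_gradient hk hp hpU hn
      have hneg := ho p n hn
      rw [hc, real_inner_smul_right, real_inner_comm, inner_gradient_left, hzero, mul_zero] at hneg
      exact hneg.false
    rcases hne.lt_or_gt with hlt | hgt
    · exact ⟨U, g, hpU, hg, hlt⟩
    · refine ⟨U, -g, hpU, hg.neg, ?_⟩
      rw [fderiv_neg]
      exact neg_lt_zero.2 hgt
  have hcont : ContinuousOn (fun y => fderiv ℝ g y (o - y)) U :=
    (hgU.contDiffOn.continuousOn_fderiv_of_isOpen hgU.isOpen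
      (ENat.one_le_iff_ne_zero_withTop.2 hk)).clm_apply (by fun_prop)
  exact ⟨U ∩ (fun y => fderiv ℝ g y (o - y)) ⁻¹' Iio 0, g, ⟨hpU, hgp⟩,
    hgU.mono (hcont.isOpen_inter_preimage hgU.isOpen isOpen_Iio) inter_subset_left,
    fun y hy => hy.2⟩

lemma exists_isOutwardDefiningFunction (hM : IsClosedConvexSurface M)
    (hreg : IsRegularSurface k M) (hk : k ≠ 0) (hp : p ∈ M) :
    ∃ V g, p ∈ V ∧ IsOutwardDefiningFunction k M V g := by
  obtain ⟨o, ho⟩ := hM.exists_inner_sub_neg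
  obtain ⟨V, g, hpV, hg, hdec⟩ := hM.exists_decreasing_isDefiningFunction hreg hk hp ho
  refine ⟨V, g, hpV, hg, fun y hy hyV => ?_⟩
  have hn := hM.isSupportingNormal_gaussMap hreg hk hy
  exact hg.eq_normalize_gradient hk hy hyV hn (ho _ _ hn) (hdec y hyV)

lemma gaussMap_eq (hM : IsClosedConvexSurface M) (hreg : IsRegularSurface k M) (hk : k ≠ 0)
    (hp : p ∈ M) (hn : IsSupportingNormal M p n) : gaussMap M p = n := by
  obtain ⟨o, ho⟩ := hM.exists_inner_sub_neg
  obtain ⟨V, g, hpV, hg, hdec⟩ := hM.exists_decreasing_isDefiningFunction hreg hk hp ho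
  have hν := hM.isSupportingNormal_gaussMap hreg hk hp
  rw [hg.eq_normalize_gradient hk hp hpV hn (ho _ _ hn) (hdec p hpV),
    hg.eq_normalize_gradient hk hp hpV hν (ho _ _ hν) (hdec p hpV)]

lemma surjOn_gaussMap (hM : IsClosedConvexSurface M) (hreg : IsRegularSurface k M) (hk : k ≠ 0) :
    SurjOn (gaussMap M) M (Metric.sphere 0 1) := fun x hx => by
  obtain ⟨p, hp, hpx⟩ := hM.exists_mem_isSupportingNormal (mem_sphere_zero_iff_norm.1 hx)
  exact ⟨p, hp, hM.gaussMap_eq hreg hk hp hpx⟩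

lemma mem_tangentConeAt_iff (hM : IsClosedConvexSurface M) (hreg : IsRegularSurface k M)
    (hk : k ≠ 0) (hp : p ∈ M) {v : Space3} :
    v ∈ tangentConeAt ℝ M p ↔ inner ℝ (gaussMap M p) v = 0 := by
  obtain ⟨V, g, hpV, hg⟩ := hM.exists_isOutwardDefiningFunction hreg hk hp
  rw [hg.mem_tangentConeAt_iff hk hp hpV, hg.gaussMap_eq p hp hpV, NormedSpace.normalize,
    real_inner_smul_left, inner_gradient_left, mul_eq_zero_iff_left]
  exact inv_ne_zero (norm_ne_zero_iff.2 (hg.gradient_ne_zero hpV))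

end IsClosedConvexSurface

end GaussMap

section ExtendedGaussMap

lemma contDiffAt_normalize {E : Type*} [NormedAddCommGroup E] [InnerProductSpace ℝ E]
    {n : WithTop ℕ∞} {x : E} (hx : x ≠ 0) : ContDiffAt ℝ n (normalize : E → E) x :=
  ((contDiffAt_norm ℝ hx).inv (norm_ne_zero_iff.2 hx)).smul contDiffAt_id

/-- An extension of the Gauss map of the zero set of `g` to a neighbourhood, along which the norm
varies transversally to the surface, so that it is a local diffeomorphism wherever the Gauss map
is one. -/
noncomputable def extendedGaussMap (g : Space3 → ℝ) (y : Space3) : Space3 :=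
  Real.exp (g y) • normalize (gradient g y)

namespace IsOutwardDefiningFunction

variable {k n : WithTop ℕ∞} {M V : Set Space3} {g : Space3 → ℝ} {p v : Space3}

lemma norm_extendedGaussMap (h : IsOutwardDefiningFunction k M V g) (hp : p ∈ V) :
    ‖extendedGaussMap g p‖ = Real.exp (g p) := by
  rw [extendedGaussMap, norm_smul, NormedSpace.norm_normalize (h.gradient_ne_zero hp), mul_one,
    Real.norm_of_nonneg (Real.exp_nonneg _)]

lemma mem_iff_norm_extendedGaussMap (h : IsOutwardDefiningFunction k M V g) (hp : p ∈ V) :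
    p ∈ M ↔ ‖extendedGaussMap g p‖ = 1 := by
  rw [h.norm_extendedGaussMap hp, Real.exp_eq_one_iff, h.mem_iff hp]

lemma extendedGaussMap_eq_gaussMap (h : IsOutwardDefiningFunction k M V g) (hp : p ∈ M)
    (hpV : p ∈ V) : extendedGaussMap g p = gaussMap M p := by
  rw [extendedGaussMap, (h.mem_iff hpV).1 hp, Real.exp_zero, one_smul, h.gaussMap_eq p hp hpV]

lemma contDiffOn_extendedGaussMap (h : IsOutwardDefiningFunction (n + 1) M V g) :
    ContDiffOn ℝ n (extendedGaussMap g) V := by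
  have hgradient : ContDiffOn ℝ n (gradient g) V :=
    (InnerProductSpace.toDual ℝ Space3).symm.contDiff.comp_contDiffOn
      (h.contDiffOn.fderiv_of_isOpen h.isOpen le_rfl)
  exact (h.contDiffOn.of_le le_self_add).exp.smul fun y hy =>
    (contDiffAt_normalize (h.gradient_ne_zero hy)).comp_contDiffWithinAt y (hgradient y hy)

lemma hasFDerivAt_extendedGaussMap (h : IsOutwardDefiningFunction (n + 1) M V g) (hn : n ≠ 0)
    (hp : p ∈ V) : HasFDerivAt (extendedGaussMap g) (fderiv ℝ (extendedGaussMap g) p) p :=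
  ((h.contDiffOn_extendedGaussMap.contDiffAt (h.isOpen.mem_nhds hp)).differentiableAt
    hn).hasFDerivAt

lemma hasFDerivWithinAt_gaussMap (h : IsOutwardDefiningFunction (n + 1) M V g) (hn : n ≠ 0)
    (hp : p ∈ M) (hpV : p ∈ V) :
    HasFDerivWithinAt (gaussMap M) (fderiv ℝ (extendedGaussMap g) p) M p := by
  refine (h.hasFDerivAt_extendedGaussMap hn hpV).hasFDerivWithinAt.congr_of_eventuallyEq ?_
    (h.extendedGaussMap_eq_gaussMap hp hpV).symm
  filter_upwards [nhdsWithin_le_nhds (h.isOpen.mem_nhds hpV), self_mem_nhdsWithin] with y hyV hy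
  exact (h.extendedGaussMap_eq_gaussMap hy hyV).symm

lemma inner_gaussMap_fderiv_extendedGaussMap (h : IsOutwardDefiningFunction (n + 1) M V g)
    (hn : n ≠ 0) (hp : p ∈ M) (hpV : p ∈ V) :
    inner ℝ (gaussMap M p) (fderiv ℝ (extendedGaussMap g) p v) = fderiv ℝ g p v := by
  have hnorm := (h.hasFDerivAt_extendedGaussMap hn hpV).norm_sq
  have hexp := ((h.hasStrictFDerivAt (by simp) hpV).hasFDerivAt.exp).pow 2
  have eventually_eq : (fun y => ‖extendedGaussMap g y‖ ^ 2) =ᶠ[𝓝 p]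
      fun y => Real.exp (g y) ^ 2 := by
    filter_upwards [h.isOpen.mem_nhds hpV] with y hy
    rw [h.norm_extendedGaussMap hy]
  have hderiv := congr($(hnorm.unique (hexp.congr_of_eventuallyEq eventually_eq)) v)
  simpa [(h.mem_iff hpV).1 hp, h.extendedGaussMap_eq_gaussMap hp hpV] using hderiv

-- A kernel vector is tangent to `M`, hence a principal direction of curvature zero.
lemma injective_fderiv_extendedGaussMap (h : IsOutwardDefiningFunction (n + 1) M V g) (hn : n ≠ 0)
    (hp : p ∈ M) (hpV : p ∈ V) (hcurv : 0 ∉ principalCurvatures M p) :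
    Function.Injective (fderiv ℝ (extendedGaussMap g) p) := by
  rw [injective_iff_map_eq_zero]
  intro v hv
  by_contra hv0
  have htangent : v ∈ tangentConeAt ℝ M p := by
    rw [h.mem_tangentConeAt_iff (by simp) hp hpV,
      ← h.inner_gaussMap_fderiv_extendedGaussMap hn hp hpV, hv, inner_zero_right]
  have hν := h.hasFDerivWithinAt_gaussMap hn hp hpV
  refine hcurv ⟨v, htangent, hv0, ?_⟩
  rw [hν.differentiableWithinAt.hasFDerivWithinAt.unique_on hν htangent, hv, zero_smul]

end IsOutwardDefiningFunction

end ExtendedGaussMap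

lemma exists_contDiffAt_right_inverse {E : Type*} [NormedAddCommGroup E] [NormedSpace ℝ E]
    [FiniteDimensional ℝ E] {n : WithTop ℕ∞} {Φ : E → E} {p : E} (hΦ : ContDiffAt ℝ n Φ p)
    (hn : n ≠ 0) (hinj : Function.Injective (fderiv ℝ Φ p)) :
    ∃ Ψ : E → E, ContDiffAt ℝ n Ψ (Φ p) ∧ Ψ (Φ p) = p ∧ ∀ᶠ y in 𝓝 (Φ p), Φ (Ψ y) = y := by
  have := FiniteDimensional.complete ℝ E
  let D := (LinearEquiv.ofInjectiveEndo (fderiv ℝ Φ p : E →ₗ[ℝ] E) hinj).toContinuousLinearEquiv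
  have hD : HasFDerivAt Φ (D : E →L[ℝ] E) p := (hΦ.differentiableAt hn).hasFDerivAt
  exact ⟨hΦ.localInverse hD hn, hΦ.to_localInverse hD hn, hΦ.localInverse_apply_image hD hn,
    (hΦ.hasStrictFDerivAt' hD hn).eventually_right_inverse⟩

section InverseGaussMap

namespace IsClosedStrictlyConvexSurface

variable {k n : WithTop ℕ∞} {M : Set Space3} {p x : Space3}

lemma norm_gaussMap (hM : IsClosedStrictlyConvexSurface k M) (hk : k ≠ 0) (hp : p ∈ M) :
    ‖gaussMap M p‖ = 1 :=
  (hM.closedConvex.isSupportingNormal_gaussMap hM.regular hk hp).1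

lemma inverseGaussMap_mem (hM : IsClosedStrictlyConvexSurface k M) (hk : k ≠ 0) (hx : ‖x‖ = 1) :
    inverseGaussMap M x ∈ M :=
  Function.invFunOn_mem (hM.closedConvex.surjOn_gaussMap hM.regular hk
    (mem_sphere_zero_iff_norm.2 hx))

lemma gaussMap_inverseGaussMap (hM : IsClosedStrictlyConvexSurface k M) (hk : k ≠ 0)
    (hx : ‖x‖ = 1) : gaussMap M (inverseGaussMap M x) = x :=
  Function.invFunOn_eq (hM.closedConvex.surjOn_gaussMap hM.regular hk
    (mem_sphere_zero_iff_norm.2 hx))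

lemma hasFDerivWithinAt_gaussMap (hM : IsClosedStrictlyConvexSurface (n + 1) M) (hn : n ≠ 0)
    (hp : p ∈ M) : HasFDerivWithinAt (gaussMap M) (fderivWithin ℝ (gaussMap M) M p) M p := by
  obtain ⟨V, g, hpV, hg⟩ :=
    hM.closedConvex.exists_isOutwardDefiningFunction hM.regular (by simp) hp
  exact (hg.hasFDerivWithinAt_gaussMap hn hp hpV).differentiableWithinAt.hasFDerivWithinAt

-- Two points with the same normal are joined by a segment in `M` along which the normal is
-- constant, so the curvature in its direction vanishes.
lemma injOn_gaussMap (hM : IsClosedStrictlyConvexSurface (n + 1) M) (hn : n ≠ 0) :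
    InjOn (gaussMap M) M := by
  intro p hp q hq hpq
  by_contra hne
  have hconv := hM.closedConvex
  have hnormal {y : Space3} (hy : y ∈ M) :=
    hconv.isSupportingNormal_gaussMap hM.regular (by simp) hy
  have hsegment := hconv.isSupportingNormal_of_mem_segment hp hq (hnormal hp) (hpq ▸ hnormal hq)
  have hsubset : segment ℝ p q ⊆ M := fun y hy => (hsegment y hy).1
  have hmem : q - p ∈ tangentConeAt ℝ (segment ℝ p q) p :=
    mem_tangentConeAt_of_segment_subset Subset.rfl
  have hconst : HasFDerivWithinAt (gaussMap M) (0 : Space3 →L[ℝ] Space3) (segment ℝ p q) p :=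
    (hasFDerivWithinAt_const (gaussMap M p) p _).congr
      (fun y hy => hconv.gaussMap_eq hM.regular (by simp) (hsubset hy) (hsegment y hy).2) rfl
  refine (hM.curvature_pos p hp 0 ⟨q - p, tangentConeAt_mono hsubset hmem,
    sub_ne_zero.2 (Ne.symm hne), ?_⟩).false
  rw [((hM.hasFDerivWithinAt_gaussMap hn hp).mono hsubset).unique_on hconst hmem, zero_smul]
  rfl

lemma inverseGaussMap_gaussMap (hM : IsClosedStrictlyConvexSurface (n + 1) M) (hn : n ≠ 0)
    (hp : p ∈ M) : inverseGaussMap M (gaussMap M p) = p :=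
  (hM.injOn_gaussMap hn).leftInvOn_invFunOn hp

lemma image_inverseGaussMap (hM : IsClosedStrictlyConvexSurface (n + 1) M) (hn : n ≠ 0) :
    inverseGaussMap M '' Metric.sphere 0 1 = M := by
  refine Subset.antisymm (image_subset_iff.2 fun x hx => ?_) fun p hp => ?_
  · exact hM.inverseGaussMap_mem (by simp) (mem_sphere_zero_iff_norm.1 hx)
  · exact ⟨_, mem_sphere_zero_iff_norm.2 (hM.norm_gaussMap (by simp) hp),
      hM.inverseGaussMap_gaussMap hn hp⟩

lemma exists_contDiffAt_eq_inverseGaussMap (hM : IsClosedStrictlyConvexSurface (n + 1) M)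
    (hn : n ≠ 0) (hx : ‖x‖ = 1) :
    ∃ Ψ, ContDiffAt ℝ n Ψ x ∧ ∀ᶠ y in 𝓝 x, ‖y‖ = 1 → inverseGaussMap M y = Ψ y := by
  have hp := hM.inverseGaussMap_mem (by simp) hx
  have hpx := hM.gaussMap_inverseGaussMap (by simp) hx
  set p := inverseGaussMap M x
  obtain ⟨V, g, hpV, hg⟩ :=
    hM.closedConvex.exists_isOutwardDefiningFunction hM.regular (by simp) hp
  have hV := hg.isOpen.mem_nhds hpV
  obtain ⟨Ψ, hΨ, hΨp, hright⟩ := exists_contDiffAt_right_inverse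
    (hg.contDiffOn_extendedGaussMap.contDiffAt hV) hn
    (hg.injective_fderiv_extendedGaussMap hn hp hpV fun h0 => (hM.curvature_pos p hp 0 h0).false)
  rw [hg.extendedGaussMap_eq_gaussMap hp hpV, hpx] at hΨ hΨp hright
  have eventually_mem : ∀ᶠ y in 𝓝 x, Ψ y ∈ V :=
    hΨ.continuousAt.eventually_mem (hΨp.symm ▸ hV)
  refine ⟨Ψ, hΨ, ?_⟩
  filter_upwards [hright, eventually_mem] with y hΦΨ hyV hy
  have hyM : Ψ y ∈ M := (hg.mem_iff_norm_extendedGaussMap hyV).2 (hΦΨ.symm ▸ hy)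
  calc inverseGaussMap M y = inverseGaussMap M (gaussMap M (Ψ y)) := by
        rw [← hg.extendedGaussMap_eq_gaussMap hyM hyV, hΦΨ]
    _ = Ψ y := hM.inverseGaussMap_gaussMap hn hyM

end IsClosedStrictlyConvexSurface

end InverseGaussMap

section SupportSymmetry

variable {E : Type*} [NormedAddCommGroup E] [InnerProductSpace ℝ E]

lemma inner_fderiv_self_eq_zero_of_support {X : E → E} {s : Set E} {x : E} (hs : s ∈ 𝓝 x)
    (hX : DifferentiableAt ℝ X x) (hsupp : ∀ y ∈ s, inner ℝ (X y - X x) x ≤ 0) (v : E) :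
    inner ℝ (fderiv ℝ X x v) x = 0 := by
  have hmax : IsLocalMax (fun y => inner ℝ (X y) x) x := by
    filter_upwards [hs] with y hy
    rw [← sub_nonpos, ← inner_sub_left]
    exact hsupp y hy
  simpa using congr($(hmax.hasFDerivAt_eq_zero (hX.hasFDerivAt.inner ℝ (hasFDerivAt_const x x))) v)

/- The support property makes `X` the gradient of `x ↦ ⟪X x, x⟫`, so its derivative is a second
derivative. -/
lemma inner_fderiv_comm_of_support {X : E → E} {s : Set E} (hs : IsOpen s)
    (hX : DifferentiableOn ℝ X s) (hsupp : ∀ x ∈ s, ∀ y ∈ s, inner ℝ (X y - X x) x ≤ 0) {x : E}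
    (hx : x ∈ s) (a b : E) : inner ℝ (fderiv ℝ X x a) b = inner ℝ a (fderiv ℝ X x b) := by
  have hXd {y : E} (hy : y ∈ s) : DifferentiableAt ℝ X y := hX.differentiableAt (hs.mem_nhds hy)
  have hgradient : ∀ᶠ y in 𝓝 x,
      HasFDerivAt (fun y => inner ℝ (X y) y) (innerSL ℝ (X y)) y := by
    filter_upwards [hs.mem_nhds hx] with y hy
    refine ((hXd hy).hasFDerivAt.inner ℝ (hasFDerivAt_id y)).congr_fderiv ?_
    ext v
    simp [inner_fderiv_self_eq_zero_of_support (hs.mem_nhds hy) (hXd hy) (hsupp y hy)]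
  have hhessian := (innerSL ℝ : E →L[ℝ] E →L[ℝ] ℝ).hasFDerivAt.comp x (hXd hx).hasFDerivAt
  have hsymm := second_derivative_symmetric_of_eventually hgradient hhessian a b
  rw [real_inner_comm _ a]
  exact hsymm

end SupportSymmetry

lemma fderiv_normalize_apply {E : Type*} [NormedAddCommGroup E] [InnerProductSpace ℝ E] {x v : E}
    (hx : ‖x‖ = 1) (hxv : inner ℝ x v = 0) : fderiv ℝ (normalize : E → E) x v = v := by
  have hx0 : x ≠ 0 := norm_ne_zero_iff.1 (hx.trans_ne one_ne_zero)
  have hproduct := (hasFDerivAt_norm hx0).smul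
    ((contDiffAt_normalize (n := 1) hx0).differentiableAt one_ne_zero).hasFDerivAt
  have hid : HasFDerivAt (fun y : E => ‖y‖ • normalize y) (.id ℝ E) x := by
    simp only [NormedSpace.norm_smul_normalize]
    exact hasFDerivAt_id x
  have hderiv := congr($(hproduct.unique hid) v)
  simpa [hx, hxv, NormedSpace.normalize_eq_self_of_norm_eq_one hx] using hderiv

section GaussParam

/-- The parametrization of the surface `M` by its inverse Gauss map, extended from the unit sphere
to be constant along rays: the gradient of the support function of `M`. -/
noncomputable def gaussParam (M : Set Space3) (x : Space3) : Space3 :=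
  inverseGaussMap M (normalize x)

lemma gaussParam_of_norm_eq_one {M : Set Space3} {x : Space3} (hx : ‖x‖ = 1) :
    gaussParam M x = inverseGaussMap M x := by
  rw [gaussParam, NormedSpace.normalize_eq_self_of_norm_eq_one hx]

namespace IsClosedStrictlyConvexSurface

variable {k n : WithTop ℕ∞} {M : Set Space3} {x v : Space3} {κ : ℝ}

lemma gaussParam_mem (hM : IsClosedStrictlyConvexSurface k M) (hk : k ≠ 0) (hx : x ≠ 0) :
    gaussParam M x ∈ M :=
  hM.inverseGaussMap_mem hk (NormedSpace.norm_normalize hx)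

lemma gaussMap_gaussParam (hM : IsClosedStrictlyConvexSurface k M) (hk : k ≠ 0) (hx : x ≠ 0) :
    gaussMap M (gaussParam M x) = normalize x :=
  hM.gaussMap_inverseGaussMap hk (NormedSpace.norm_normalize hx)

lemma gaussParam_gaussMap (hM : IsClosedStrictlyConvexSurface (n + 1) M) (hn : n ≠ 0)
    {p : Space3} (hp : p ∈ M) : gaussParam M (gaussMap M p) = p := by
  rw [gaussParam_of_norm_eq_one (hM.norm_gaussMap (by simp) hp), hM.inverseGaussMap_gaussMap hn hp]

lemma inner_gaussParam_sub_nonpos (hM : IsClosedStrictlyConvexSurface k M) (hk : k ≠ 0)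
    (hx : x ≠ 0) {y : Space3} (hy : y ≠ 0) : inner ℝ (gaussParam M y - gaussParam M x) x ≤ 0 := by
  have hnormal :=
    hM.closedConvex.isSupportingNormal_gaussMap hM.regular hk (hM.gaussParam_mem hk hx)
  rw [hM.gaussMap_gaussParam hk hx] at hnormal
  rw [← NormedSpace.norm_smul_normalize x, real_inner_smul_right, NormedSpace.norm_smul_normalize]
  exact mul_nonpos_of_nonneg_of_nonpos (norm_nonneg x) (hnormal.2 _ (hM.gaussParam_mem hk hy))

lemma contDiffAt_gaussParam (hM : IsClosedStrictlyConvexSurface (n + 1) M) (hn : n ≠ 0)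
    (hx : x ≠ 0) : ContDiffAt ℝ n (gaussParam M) x := by
  obtain ⟨Ψ, hΨ, hloc⟩ := hM.exists_contDiffAt_eq_inverseGaussMap hn (NormedSpace.norm_normalize hx)
  have hnormalize : ContDiffAt ℝ n NormedSpace.normalize x := contDiffAt_normalize hx
  refine (hΨ.comp x hnormalize).congr_of_eventuallyEq ?_
  filter_upwards [hnormalize.continuousAt.eventually hloc, eventually_ne_nhds hx] with y hy hy0
  exact hy (NormedSpace.norm_normalize hy0)

lemma hasFDerivAt_gaussParam (hM : IsClosedStrictlyConvexSurface (n + 1) M) (hn : n ≠ 0)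
    (hx : x ≠ 0) : HasFDerivAt (gaussParam M) (fderiv ℝ (gaussParam M) x) x :=
  ((hM.contDiffAt_gaussParam hn hx).differentiableAt hn).hasFDerivAt

lemma isSupportGradient_gaussParam (hM : IsClosedStrictlyConvexSurface (2 + 1) M) :
    IsSupportGradient (gaussParam M) where
  contDiffOn _ hx := (hM.contDiffAt_gaussParam two_ne_zero hx).contDiffWithinAt
  map_smul c hc x := by rw [gaussParam, NormedSpace.normalize_smul_of_pos hc, gaussParam]
  symm _ hx := inner_fderiv_comm_of_support isOpen_compl_singleton
    (fun _ hy => (hM.hasFDerivAt_gaussParam two_ne_zero hy).differentiableAt.differentiableWithinAt)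
    (fun _ hx _ hy => hM.inner_gaussParam_sub_nonpos (by simp) hx hy) hx

lemma mem_tangentConeAt_gaussParam_iff (hM : IsClosedStrictlyConvexSurface k M) (hk : k ≠ 0)
    (hx : ‖x‖ = 1) : v ∈ tangentConeAt ℝ M (gaussParam M x) ↔ inner ℝ x v = 0 := by
  have hx0 : x ≠ 0 := norm_ne_zero_iff.1 (hx.trans_ne one_ne_zero)
  rw [hM.closedConvex.mem_tangentConeAt_iff hM.regular hk (hM.gaussParam_mem hk hx0),
    hM.gaussMap_gaussParam hk hx0, NormedSpace.normalize_eq_self_of_norm_eq_one hx]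

lemma fderiv_gaussParam_fderivWithin_gaussMap (hM : IsClosedStrictlyConvexSurface (n + 1) M)
    (hn : n ≠ 0) (hx : ‖x‖ = 1) (hv : inner ℝ x v = 0) :
    fderiv ℝ (gaussParam M) x (fderivWithin ℝ (gaussMap M) M (gaussParam M x) v) = v := by
  have hx0 : x ≠ 0 := norm_ne_zero_iff.1 (hx.trans_ne one_ne_zero)
  have hp := hM.gaussParam_mem (by simp) hx0
  have hνp : gaussMap M (gaussParam M x) = x := by
    rw [hM.gaussMap_gaussParam (by simp) hx0, NormedSpace.normalize_eq_self_of_norm_eq_one hx]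
  have hcomp := HasFDerivAt.comp_hasFDerivWithinAt _
    (hνp.symm ▸ hM.hasFDerivAt_gaussParam hn hx0) (hM.hasFDerivWithinAt_gaussMap hn hp)
  have hid : HasFDerivWithinAt (gaussParam M ∘ gaussMap M) (.id ℝ Space3) M (gaussParam M x) :=
    (hasFDerivWithinAt_id _ M).congr (fun y hy => hM.gaussParam_gaussMap hn hy)
      (hM.gaussParam_gaussMap hn hp)
  have heq := hcomp.unique_on hid ((hM.mem_tangentConeAt_gaussParam_iff (by simp) hx).2 hv)
  simpa [hνp] using heq

lemma fderivWithin_gaussMap_fderiv_gaussParam (hM : IsClosedStrictlyConvexSurface (n + 1) M)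
    (hn : n ≠ 0) (hx : ‖x‖ = 1) (hv : inner ℝ x v = 0) :
    fderivWithin ℝ (gaussMap M) M (gaussParam M x) (fderiv ℝ (gaussParam M) x v) = v := by
  have hx0 : x ≠ 0 := norm_ne_zero_iff.1 (hx.trans_ne one_ne_zero)
  have eventually_mem : ∀ᶠ y in 𝓝 x, gaussParam M y ∈ M := by
    filter_upwards [eventually_ne_nhds hx0] with y hy using hM.gaussParam_mem (by simp) hy
  have hcomp := (hM.hasFDerivWithinAt_gaussMap hn (hM.gaussParam_mem (by simp) hx0)
    ).comp_hasFDerivAt x (hM.hasFDerivAt_gaussParam hn hx0) eventually_mem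
  have heq : gaussMap M ∘ gaussParam M =ᶠ[𝓝 x] NormedSpace.normalize := by
    filter_upwards [eventually_ne_nhds hx0] with y hy using hM.gaussMap_gaussParam (by simp) hy
  have hderiv := congr($(hcomp.fderiv) v)
  rw [heq.fderiv_eq, fderiv_normalize_apply hx hv] at hderiv
  exact hderiv.symm

lemma mem_principalCurvatures_gaussParam_iff (hM : IsClosedStrictlyConvexSurface (n + 1) M)
    (hn : n ≠ 0) (hx : ‖x‖ = 1) : κ ∈ principalCurvatures M (gaussParam M x) ↔
      ∃ v, inner ℝ x v = 0 ∧ v ≠ 0 ∧ fderiv ℝ (gaussParam M) x v = κ⁻¹ • v := by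
  have hx0 : x ≠ 0 := norm_ne_zero_iff.1 (hx.trans_ne one_ne_zero)
  constructor
  · intro hκ
    have hκ0 := (hM.curvature_pos _ (hM.gaussParam_mem (by simp) hx0) κ hκ).ne'
    obtain ⟨v, hv, hv0, hSv⟩ := hκ
    rw [hM.mem_tangentConeAt_gaussParam_iff (by simp) hx] at hv
    have hinv := hM.fderiv_gaussParam_fderivWithin_gaussMap hn hx hv
    rw [hSv, map_smul] at hinv
    exact ⟨v, hv, hv0, by rw [eq_inv_smul_iff₀ hκ0, hinv]⟩
  · rintro ⟨v, hv, hv0, hWv⟩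
    have hinv := hM.fderivWithin_gaussMap_fderiv_gaussParam hn hx hv
    rw [hWv, map_smul] at hinv
    have hκ0 : κ ≠ 0 := by
      rintro rfl
      exact hv0 (by rw [← hinv, inv_zero, zero_smul])
    exact ⟨v, (hM.mem_tangentConeAt_gaussParam_iff (by simp) hx).2 hv, hv0,
      (inv_smul_eq_iff₀ hκ0).1 hinv⟩

end IsClosedStrictlyConvexSurface

end GaussParam

section Eigenvalues

open ComplexConjugate

lemma exists_ne_zero_mul_eq_mul_conj_iff {c : ℝ} {w : ℂ} :
    (∃ ζ : ℂ, ζ ≠ 0 ∧ c * ζ = w * conj ζ) ↔ |c| = ‖w‖ := by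
  constructor
  · rintro ⟨ζ, hζ, heq⟩
    have hnorm := congrArg norm heq
    rw [norm_mul, norm_mul, RCLike.norm_conj, Complex.norm_real, Real.norm_eq_abs] at hnorm
    exact mul_right_cancel₀ (norm_ne_zero_iff.2 hζ) hnorm
  · intro hcw
    rcases eq_or_ne c 0 with rfl | hc
    · exact ⟨1, one_ne_zero, by simp [norm_eq_zero.1 (hcw.symm.trans abs_zero)]⟩
    have hcℂ : (c : ℂ) ≠ 0 := Complex.ofReal_ne_zero.2 hc
    obtain ⟨ζ, hζ⟩ := IsAlgClosed.exists_pow_nat_eq (w / c) two_pos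
    have hζ_norm : ‖ζ‖ = 1 := by
      rw [← pow_eq_one_iff_of_nonneg (norm_nonneg ζ) two_ne_zero, ← norm_pow, hζ, norm_div,
        Complex.norm_real, Real.norm_eq_abs, hcw, div_self (hcw ▸ abs_ne_zero.2 hc)]
    refine ⟨ζ, norm_ne_zero_iff.1 (hζ_norm.trans_ne one_ne_zero), ?_⟩
    calc c * ζ = c * ζ * (ζ * conj ζ) := by rw [Complex.mul_conj']; simp [hζ_norm]
      _ = c * ζ ^ 2 * conj ζ := by ring
      _ = w * conj ζ := by rw [hζ, mul_div_cancel₀ w hcℂ]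

/-- The vector with complex coordinate `ζ` in the plane spanned by the frame `a, b`. -/
def planeVector {E : Type*} [AddCommGroup E] [Module ℝ E] (a b : E) (ζ : ℂ) : E :=
  ζ.re • a + ζ.im • b

namespace IsFrame

variable {x a b v : Space3} {W : Space3 →L[ℝ] Space3} {ζ ξ : ℂ} {μ : ℝ}

lemma inner_planeVector_left (hf : IsFrame x a b) : inner ℝ a (planeVector a b ζ) = ζ.re := by
  simp [planeVector, inner_add_right, real_inner_smul_right, hf.inner_ab, hf.norm_a]

lemma inner_planeVector_right (hf : IsFrame x a b) : inner ℝ b (planeVector a b ζ) = ζ.im := by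
  simp [planeVector, inner_add_right, real_inner_smul_right, real_inner_comm a b, hf.inner_ab,
    hf.norm_b]

lemma planeVector_inj (hf : IsFrame x a b) : planeVector a b ζ = planeVector a b ξ ↔ ζ = ξ := by
  refine ⟨fun h => Complex.ext ?_ ?_, congrArg _⟩
  · rw [← hf.inner_planeVector_left, h, hf.inner_planeVector_left]
  · rw [← hf.inner_planeVector_right, h, hf.inner_planeVector_right]

lemma inner_eq_zero_iff_exists_planeVector (hf : IsFrame x a b) :
    inner ℝ x v = 0 ↔ ∃ ζ, planeVector a b ζ = v :=
  ⟨fun hv => ⟨⟨inner ℝ a v, inner ℝ b v⟩, (hf.expand hv).symm⟩,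
    fun ⟨ζ, hζ⟩ => hζ ▸ hf.inner_comb ζ.re ζ.im⟩

lemma apply_planeVector (hf : IsFrame x a b) (hsymm : ∀ u v, inner ℝ (W u) v = inner ℝ u (W v))
    (hWx : W x = 0) : W (planeVector a b ζ) =
      planeVector a b ((planarForm W a b).1 * ζ + (planarForm W a b).2 * conj ζ) := by
  have hperp : inner ℝ x (W (planeVector a b ζ)) = 0 := by rw [← hsymm, hWx, inner_zero_left]
  have hba : inner ℝ (W b) a = inner ℝ (W a) b := by rw [hsymm, real_inner_comm]
  obtain ⟨ξ, hξ⟩ := hf.inner_eq_zero_iff_exists_planeVector.1 hperp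
  rw [← hξ, hf.planeVector_inj]
  apply Complex.ext
  · rw [← hf.inner_planeVector_left (ζ := ξ), hξ, ← hsymm, planeVector, inner_add_right,
      real_inner_smul_right, real_inner_smul_right]
    simp [planarForm]
    ring
  · rw [← hf.inner_planeVector_right (ζ := ξ), hξ, ← hsymm, planeVector, inner_add_right,
      real_inner_smul_right, real_inner_smul_right, hba]
    simp [planarForm]
    ring

lemma exists_eigenvector_iff (hf : IsFrame x a b)
    (hsymm : ∀ u v, inner ℝ (W u) v = inner ℝ u (W v)) (hWx : W x = 0) :
    (∃ v, inner ℝ x v = 0 ∧ v ≠ 0 ∧ W v = μ • v) ↔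
      |μ - (planarForm W a b).1| = ‖(planarForm W a b).2‖ := by
  have hzero : planeVector a b 0 = 0 := by simp [planeVector]
  have hsmul (ζ : ℂ) : μ • planeVector a b ζ = planeVector a b (μ * ζ) := by
    simp [planeVector, mul_smul]
  have heigen (ζ : ℂ) : W (planeVector a b ζ) = μ • planeVector a b ζ ↔
      ((μ - (planarForm W a b).1 : ℝ) : ℂ) * ζ = (planarForm W a b).2 * conj ζ := by
    rw [hf.apply_planeVector hsymm hWx, hsmul, hf.planeVector_inj, Complex.ofReal_sub, sub_mul,
      sub_eq_iff_eq_add', eq_comm]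
  simp only [← exists_ne_zero_mul_eq_mul_conj_iff, hf.inner_eq_zero_iff_exists_planeVector,
    ← heigen, ne_eq, ← hf.planeVector_inj (ξ := 0), hzero]
  constructor
  · rintro ⟨_, ⟨ζ, rfl⟩, hζ⟩
    exact ⟨ζ, hζ⟩
  · rintro ⟨ζ, hζ⟩
    exact ⟨_, ⟨ζ, rfl⟩, hζ⟩

end IsFrame

end Eigenvalues

section PrincipalRadii

namespace IsClosedStrictlyConvexSurface

variable {M : Set Space3} {x a b : Space3} {m ρ : ℝ}

lemma principalCurvatures_gaussParam (hM : IsClosedStrictlyConvexSurface (2 + 1) M)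
    (hf : IsFrame x a b)
    (hradii : radialPart (planarForm (fderiv ℝ (gaussParam M) x) a b) = (m, ρ)) :
    principalCurvatures M (gaussParam M x) = {(m + ρ)⁻¹, (m - ρ)⁻¹} := by
  obtain ⟨rfl, rfl⟩ := Prod.mk.inj hradii
  have hgrad := hM.isSupportGradient_gaussParam
  ext κ
  rw [hM.mem_principalCurvatures_gaussParam_iff two_ne_zero hf.norm_x,
    hf.exists_eigenvector_iff (hgrad.symm x hf.ne_zero) (hgrad.fderiv_self hf.ne_zero),
    abs_eq (norm_nonneg _), mem_insert_iff, mem_singleton_iff, sub_eq_iff_eq_add',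
    sub_eq_iff_eq_add', ← sub_eq_add_neg, inv_eq_iff_eq_inv, inv_eq_iff_eq_inv]

lemma hasPositiveRadii_gaussParam (hM : IsClosedStrictlyConvexSurface (2 + 1) M) :
    HasPositiveRadii (gaussParam M) := fun x a b hf =>
  sub_pos.1 <| inv_pos.1 <| hM.curvature_pos _ (hM.gaussParam_mem (by simp) hf.ne_zero) _ <| by
    rw [hM.principalCurvatures_gaussParam hf rfl]
    exact mem_insert_of_mem _ rfl

lemma kappa_inverseGaussMap (hM : IsClosedStrictlyConvexSurface (2 + 1) M)
    (hf : IsFrame x a b)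
    (hradii : radialPart (planarForm (fderiv ℝ (gaussParam M) x) a b) = (m, ρ)) :
    kappa1 M (inverseGaussMap M x) = (m - ρ)⁻¹ ∧ kappa2 M (inverseGaussMap M x) = (m + ρ)⁻¹ := by
  have hpos : (m, ρ) ∈ positiveCone ℝ :=
    hradii ▸ radialPart_mem_positiveCone.2 (hM.hasPositiveRadii_gaussParam x a b hf)
  have hρ : 0 ≤ ρ := (norm_nonneg _).trans_eq (Prod.mk.inj hradii).2
  have hlt : ρ < m := (le_abs_self ρ).trans_lt hpos
  have hle : (m + ρ)⁻¹ ≤ (m - ρ)⁻¹ := inv_anti₀ (sub_pos.2 hlt) (by linarith)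
  rw [← gaussParam_of_norm_eq_one hf.norm_x, kappa1, kappa2,
    hM.principalCurvatures_gaussParam hf hradii, csSup_pair, csInf_pair]
  exact ⟨sup_of_le_right hle, inf_of_le_left hle⟩

end IsClosedStrictlyConvexSurface

end PrincipalRadii

section CurvatureFunction

/-- The principal curvatures `(1 / (m - q), 1 / (m + q))` of a surface whose principal radii have
half sum `m` and half difference `q`. -/
noncomputable def curvaturesOfRadii (p : ℝ × ℝ) : ℝ × ℝ := ((p.1 - p.2)⁻¹, (p.1 + p.2)⁻¹)

lemma radii_pos {p : ℝ × ℝ} (hp : p ∈ positiveCone ℝ) : 0 < p.1 - p.2 ∧ 0 < p.1 + p.2 := by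
  obtain ⟨h, h'⟩ := abs_lt.1 (show |p.2| < p.1 from hp)
  constructor <;> linarith

lemma curvaturesOfRadii_mem {p : ℝ × ℝ} (hp : p ∈ positiveCone ℝ) :
    curvaturesOfRadii p ∈ Ioi (0 : ℝ) ×ˢ Ioi (0 : ℝ) :=
  ⟨inv_pos.2 (radii_pos hp).1, inv_pos.2 (radii_pos hp).2⟩

lemma contDiffOn_curvaturesOfRadii {n : WithTop ℕ∞} :
    ContDiffOn ℝ n curvaturesOfRadii (positiveCone ℝ) :=
  ((contDiffOn_fst.sub contDiffOn_snd).inv fun _ hp => (radii_pos hp).1.ne').prodMk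
    ((contDiffOn_fst.add contDiffOn_snd).inv fun _ hp => (radii_pos hp).2.ne')

lemma fderiv_comp_curvaturesOfRadii {F : ℝ × ℝ → ℝ} {p : ℝ × ℝ} (hp : p ∈ positiveCone ℝ)
    (hF : DifferentiableAt ℝ F (curvaturesOfRadii p)) (s t : ℝ) :
    fderiv ℝ (F ∘ curvaturesOfRadii) p (s, t) =
      (t - s) * (((p.1 - p.2) ^ 2)⁻¹ * fderiv ℝ F (curvaturesOfRadii p) (1, 0)) -
        (s + t) * (((p.1 + p.2) ^ 2)⁻¹ * fderiv ℝ F (curvaturesOfRadii p) (0, 1)) := by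
  have hfst : HasFDerivAt (fun p : ℝ × ℝ => (p.1 - p.2)⁻¹) _ p :=
    (hasDerivAt_inv (radii_pos hp).1.ne').comp_hasFDerivAt (f := fun p : ℝ × ℝ => p.1 - p.2) p
      ((hasFDerivAt_fst (𝕜 := ℝ) (p := p)).sub hasFDerivAt_snd)
  have hsnd : HasFDerivAt (fun p : ℝ × ℝ => (p.1 + p.2)⁻¹) _ p :=
    (hasDerivAt_inv (radii_pos hp).2.ne').comp_hasFDerivAt (f := fun p : ℝ × ℝ => p.1 + p.2) p
      ((hasFDerivAt_fst (𝕜 := ℝ) (p := p)).add hasFDerivAt_snd)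
  have hchain : HasFDerivAt (F ∘ curvaturesOfRadii) _ p :=
    HasFDerivAt.comp p hF.hasFDerivAt (hfst.prodMk hsnd)
  have hsplit (u v : ℝ) : (u, v) = u • ((1 : ℝ), (0 : ℝ)) + v • ((0 : ℝ), (1 : ℝ)) := by simp
  rw [hchain.fderiv, ContinuousLinearMap.comp_apply, ContinuousLinearMap.prod_apply, hsplit,
    map_add, map_smul, map_smul]
  simp
  ring

lemma isEllipticRadial_comp_curvaturesOfRadii {F : ℝ × ℝ → ℝ}
    (hF : ContDiffOn ℝ 2 F (Ioi 0 ×ˢ Ioi 0))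
    (hsymm : ∀ y₁ > 0, ∀ y₂ > 0, F (y₁, y₂) = F (y₂, y₁))
    (hneg₁ : ∀ y ∈ Ioi (0 : ℝ) ×ˢ Ioi (0 : ℝ), fderiv ℝ F y (1, 0) < 0)
    (hneg₂ : ∀ y ∈ Ioi (0 : ℝ) ×ˢ Ioi (0 : ℝ), fderiv ℝ F y (0, 1) < 0) :
    IsEllipticRadial (F ∘ curvaturesOfRadii) where
  contDiffOn := hF.comp contDiffOn_curvaturesOfRadii fun _ => curvaturesOfRadii_mem
  even m q hp := by
    obtain ⟨hsub, hadd⟩ := curvaturesOfRadii_mem hp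
    simpa [curvaturesOfRadii, ← sub_eq_add_neg] using hsymm _ hadd _ hsub
  elliptic p hp := by
    have hy := curvaturesOfRadii_mem hp
    have hdiff : DifferentiableAt ℝ F (curvaturesOfRadii p) :=
      (hF.contDiffAt ((isOpen_Ioi.prod isOpen_Ioi).mem_nhds hy)).differentiableAt two_ne_zero
    have hfst := mul_neg_of_pos_of_neg (inv_pos.2 (pow_pos (radii_pos hp).1 2)) (hneg₁ _ hy)
    have hsnd := mul_neg_of_pos_of_neg (inv_pos.2 (pow_pos (radii_pos hp).2 2)) (hneg₂ _ hy)
    rw [fderiv_comp_curvaturesOfRadii hp hdiff, fderiv_comp_curvaturesOfRadii hp hdiff, abs_lt]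
    constructor <;> linarith

lemma fderiv_mul_fderiv_pos {f : ℝ → ℝ → ℝ} {y : ℝ × ℝ}
    (hf : DifferentiableAt ℝ (fun y : ℝ × ℝ => f y.1 y.2) y)
    (hderiv : 0 < deriv (fun s => f s y.2) y.1 * deriv (fun s => f y.1 s) y.2) :
    0 < fderiv ℝ (fun y : ℝ × ℝ => f y.1 y.2) y (1, 0) *
      fderiv ℝ (fun y : ℝ × ℝ => f y.1 y.2) y (0, 1) := by
  have hfst : HasDerivAt (fun s => f s y.2) _ y.1 :=
    hf.hasFDerivAt.comp_hasDerivAt (f := fun s => (s, y.2)) y.1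
      ((hasDerivAt_id y.1).prodMk (hasDerivAt_const y.1 y.2))
  have hsnd : HasDerivAt (fun s => f y.1 s) _ y.2 :=
    hf.hasFDerivAt.comp_hasDerivAt (f := fun s => (y.1, s)) y.2
      ((hasDerivAt_const y.2 y.1).prodMk (hasDerivAt_id y.2))
  rwa [hfst.deriv, hsnd.deriv] at hderiv

lemma exists_isEllipticRadial_smul {f : ℝ → ℝ → ℝ}
    (hf : ContDiffOn ℝ 2 (fun y : ℝ × ℝ => f y.1 y.2) (Ioi 0 ×ˢ Ioi 0))
    (hsymm : ∀ y₁ > 0, ∀ y₂ > 0, f y₁ y₂ = f y₂ y₁)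
    (hderiv : ∀ y₁ > 0, ∀ y₂ > 0,
      0 < deriv (fun s => f s y₂) y₁ * deriv (fun s => f y₁ s) y₂) :
    ∃ ε : ℝ, IsEllipticRadial ((fun y => ε * f y.1 y.2) ∘ curvaturesOfRadii) := by
  have hopen : IsOpen (Ioi (0 : ℝ) ×ˢ Ioi (0 : ℝ)) := isOpen_Ioi.prod isOpen_Ioi
  have hdiff {y : ℝ × ℝ} (hy : y ∈ Ioi (0 : ℝ) ×ˢ Ioi (0 : ℝ)) :
      DifferentiableAt ℝ (fun y : ℝ × ℝ => f y.1 y.2) y :=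
    (hf.contDiffAt (hopen.mem_nhds hy)).differentiableAt two_ne_zero
  have hprod {y : ℝ × ℝ} (hy : y ∈ Ioi (0 : ℝ) ×ˢ Ioi (0 : ℝ)) :=
    fderiv_mul_fderiv_pos (hdiff hy) (hderiv y.1 hy.1 y.2 hy.2)
  have hcont : ContinuousOn (fun y => fderiv ℝ (fun y : ℝ × ℝ => f y.1 y.2) y (1, 0))
      (Ioi 0 ×ˢ Ioi 0) :=
    (hf.continuousOn_fderiv_of_isOpen hopen one_le_two).clm_apply continuousOn_const
  have hconn : IsPreconnected (Ioi (0 : ℝ) ×ˢ Ioi (0 : ℝ)) :=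
    ((convex_Ioi (0 : ℝ)).prod (convex_Ioi 0)).isPreconnected
  rcases forall_pos_or_forall_neg hconn hcont fun y hy => left_ne_zero_of_mul (hprod hy).ne'
    with hpos | hneg
  · refine ⟨-1, ?_⟩
    simp only [neg_one_mul]
    refine isEllipticRadial_comp_curvaturesOfRadii hf.neg
      (fun y₁ h₁ y₂ h₂ => congrArg Neg.neg (hsymm y₁ h₁ y₂ h₂)) (fun y hy => ?_) fun y hy => ?_ <;>
      rw [fderiv_fun_neg, neg_apply, neg_lt_zero]
    exacts [hpos y hy, pos_of_mul_pos_right (hprod hy) (hpos y hy).le]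
  · refine ⟨1, ?_⟩
    simp only [one_mul]
    exact isEllipticRadial_comp_curvaturesOfRadii hf hsymm hneg fun y hy =>
      neg_of_mul_pos_right (hprod hy) (hneg y hy).le

end CurvatureFunction

section Conclusion

variable {M₁ M₂ : Set Space3}

lemma haveEqualCurvature_gaussParam {F : ℝ × ℝ → ℝ}
    (hM₁ : IsClosedStrictlyConvexSurface (2 + 1) M₁)
    (hM₂ : IsClosedStrictlyConvexSurface (2 + 1) M₂)
    (hmatch : ∀ x ∈ Metric.sphere (0 : Space3) 1,
      F (kappa1 M₁ (inverseGaussMap M₁ x), kappa2 M₁ (inverseGaussMap M₁ x)) =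
        F (kappa1 M₂ (inverseGaussMap M₂ x), kappa2 M₂ (inverseGaussMap M₂ x))) :
    HaveEqualCurvature (F ∘ curvaturesOfRadii) (gaussParam M₁) (gaussParam M₂) := by
  intro x a b hf
  have hx := hmatch x (mem_sphere_zero_iff_norm.2 hf.norm_x)
  obtain ⟨hκ₁, hκ₂⟩ := hM₁.kappa_inverseGaussMap hf rfl
  obtain ⟨hκ₁', hκ₂'⟩ := hM₂.kappa_inverseGaussMap hf rfl
  rwa [hκ₁, hκ₂, hκ₁', hκ₂'] at hx

lemma eq_image_add_of_gaussParam_sub_eq {c : Space3}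
    (hM₁ : IsClosedStrictlyConvexSurface (2 + 1) M₁)
    (hM₂ : IsClosedStrictlyConvexSurface (2 + 1) M₂)
    (hc : ∀ x ≠ 0, (gaussParam M₂ - gaussParam M₁) x = c) : M₂ = (· + c) '' M₁ := by
  have htranslate : ∀ x ∈ Metric.sphere (0 : Space3) 1,
      inverseGaussMap M₂ x = inverseGaussMap M₁ x + c := fun x hx => by
    have hx1 := mem_sphere_zero_iff_norm.1 hx
    rw [← gaussParam_of_norm_eq_one hx1, ← gaussParam_of_norm_eq_one hx1, ← sub_eq_iff_eq_add']
    exact hc x (norm_ne_zero_iff.1 (hx1.trans_ne one_ne_zero))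
  calc M₂ = inverseGaussMap M₂ '' Metric.sphere 0 1 := (hM₂.image_inverseGaussMap two_ne_zero).symm
    _ = (· + c) '' (inverseGaussMap M₁ '' Metric.sphere 0 1) := by
        rw [image_image, image_congr htranslate]
    _ = (· + c) '' M₁ := by rw [hM₁.image_inverseGaussMap two_ne_zero]

end Conclusion

theorem corollaryC3 (f : ℝ → ℝ → ℝ)
    (hf : ContDiffOn ℝ 2 (fun y : ℝ × ℝ => f y.1 y.2) (Ioi 0 ×ˢ Ioi 0))
    (hsymm : ∀ y₁ > 0, ∀ y₂ > 0, f y₁ y₂ = f y₂ y₁)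
    (hderiv : ∀ y₁ > 0, ∀ y₂ > 0,
      0 < deriv (fun s => f s y₂) y₁ * deriv (fun s => f y₁ s) y₂)
    (M₁ M₂ : Set Space3)
    (hM₁ : IsClosedStrictlyConvexSurface 3 M₁) (hM₂ : IsClosedStrictlyConvexSurface 3 M₂)
    (hmatch : ∀ x ∈ Metric.sphere (0 : Space3) 1,
      f (kappa1 M₁ (inverseGaussMap M₁ x)) (kappa2 M₁ (inverseGaussMap M₁ x)) =
        f (kappa1 M₂ (inverseGaussMap M₂ x)) (kappa2 M₂ (inverseGaussMap M₂ x))) :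
    ∃ a : Space3, M₂ = (fun y => y + a) '' M₁ := by
  rw [← two_add_one_eq_three] at hM₁ hM₂
  obtain ⟨ε, hG⟩ := exists_isEllipticRadial_smul hf hsymm hderiv
  have hcurvature := haveEqualCurvature_gaussParam (F := fun y => ε * f y.1 y.2) hM₁ hM₂
    fun x hx => congrArg (ε * ·) (hmatch x hx)
  obtain ⟨c, hc⟩ := exists_sub_eq_const hG hM₂.isSupportGradient_gaussParam
    hM₁.isSupportGradient_gaussParam hM₂.hasPositiveRadii_gaussParam
    hM₁.hasPositiveRadii_gaussParam hcurvature.symm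
  exact ⟨c, eq_image_add_of_gaussParam_sub_eq hM₁ hM₂ hc⟩
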